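/- Let $\Gamma=[-\pi,\pi)$. Let $H^1_{\rm per}$ be the Hilbert space of complex-valued, $2\pi$-periodic, locally absolutely continuous functions $u$ on $\mathbb{R}$ with $u'\in L^2(\Gamma)$, with inner product $\langle u,v\rangle=\int_\Gamma \overline{u'}v'+\int_\Gamma\overline{u}v$, and let $H^{-1}_{\rm per}$ be its dual, with the dual norm and the (bilinear) pairing $\langle V,\varphi\rangle$; $V$ is called real-valued if $\langle V,\overline{\varphi}\rangle=\overline{\langle V,\varphi\rangle}$ for all $\varphi\in H^1_{\rm per}$. Let $\mathcal{M}^+_{\rm per}$ be the set of non-negative $2\pi$-periodic Borel measures $\nu$ on $\mathbb{R}$ with $\nu(\Gamma)<\infty$. For $\nu\in\mathcal{M}^+_{\rm per}$ let $V_\nu\in H^{-1}_{\rm per}$ be given by $\langle V_\nu,\varphi\rangle=\int_\Gamma\varphi\,d\nu$, and for $B\in\mathbb{R}$ let $\mathcal{V}_B$ be the set of real-valued $V\in H^{-1}_{\rm per}$ of the form $V=V_\nu-B$ with $\nu\in\mathcal{M}^+_{\rm per}$, where $B$ also denotes the functional $\varphi\mapsto B\int_\Gamma\varphi\,dx$.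 For $V \in H^{-1}_{\rm per}$ real-valued and $q\in\mathbb{R}$ let $A^V_q$ be the self-adjoint operator on $L^2_{\rm per}$ associated with the form $$a^V_q(v,w)=\int_\Gamma\overline{\left(-i\tfrac{d}{dx}+q\right)v}\,\left(-i\tfrac{d}{dx}+q\right)w\,dx+\langle V,\overline{v}w\rangle,\qquad v,w\in H^1_{\rm per},$$ and let $\varepsilon^V_{q,1}\le\varepsilon^V_{q,2}\le\cdots$ be its eigenvalues, counted with multiplicity. Proposition 4. Let $B\in\mathbb{R}$ and let $(V_n)\subset\mathcal{V}_B$ be a sequence with $\sup_n\langle V_n,1\rangle<\infty$. For each $n$ let $\nu_n\in\mathcal{M}^+_{\rm per}$ be such that $V_n=V_{\nu_n}-B$. Then there exist $\nu\in\mathcal{M}^+_{\rm per}$ and a subsequence (still denoted by $n$) such that $\nu_n$ converges weakly-$*$ to $\nu$, that is, $\int_\Gamma f\,d\nu_n\to\int_\Gamma f\,d\nu$ for every continuous $2\pi$-periodic $f$; such that $V_n$ converges to $V:=V_\nu-B\in\mathcal{V}_B$ strongly (in norm) in $H^{-1}_{\rm per}$; and such that, along the same subsequence, for every integer $m\ge1$,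 $$\max_{q\in[0,1/2]}\left|\varepsilon^{V_n}_{q,m}-\varepsilon^V_{q,m}\right|\longrightarrow0\qquad(n\to\infty).$$ -/

import Mathlib

open Filter MeasureTheory Set Topology
open scoped ComplexConjugate

noncomputable section

namespace HillBands

/-- The unit cell `Γ = [-π, π)`. -/
def Γ : Set ℝ := Ico (-Real.pi) Real.pi

/-- Lebesgue measure on the unit cell. -/
def volΓ : Measure ℝ := (volume : Measure ℝ).restrict Γ

instance : IsFiniteMeasure volΓ := by
  refine ⟨?_⟩
  simp [volΓ, Γ]

theorem measurableSet_Γ : MeasurableSet Γ := measurableSet_Ico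

/-! ### The periodic Sobolev space of order one -/

/-- `u : ℝ → ℂ` is (the continuous representative of) an element of `H¹_per`: it is `2π`-periodic,
locally absolutely continuous, and its derivative is square integrable over the unit cell. -/
structure IsH1 (u : ℝ → ℂ) : Prop where
  periodic : Function.Periodic u (2 * Real.pi)
  absCont : ∀ a b : ℝ, AbsolutelyContinuousOnInterval u a b
  memLp_deriv : MemLp (deriv u) 2 volΓ

theorem IsH1.continuous {u : ℝ → ℂ} (h : IsH1 u) : Continuous u := by
  rw [continuous_iff_continuousAt]
  intro x
  refine (h.absCont (x - 1) (x + 1)).continuousOn.continuousAt ?_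
  rw [uIcc_of_le (by linarith)]
  exact Icc_mem_nhds (by linarith) (by linarith)

theorem IsH1.ae_differentiableAt {u : ℝ → ℂ} (h : IsH1 u) :
    ∀ᵐ x ∂volΓ, DifferentiableAt ℝ u x := by
  rw [volΓ, ae_restrict_iff' measurableSet_Γ]
  filter_upwards [(h.absCont (-Real.pi) Real.pi).boundedVariationOn.ae_differentiableAt_of_mem_uIcc]
    with x hx hxΓ
  refine hx ?_
  rw [uIcc_of_le (by linarith [Real.pi_pos])]
  exact Ico_subset_Icc_self hxΓ

theorem IsH1.memLp_top {u : ℝ → ℂ} (h : IsH1 u) : MemLp u ⊤ volΓ := by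
  obtain ⟨C, hC⟩ := (h.absCont (-Real.pi) Real.pi).exists_bound
  refine memLp_top_of_bound h.continuous.aestronglyMeasurable C ?_
  rw [volΓ, ae_restrict_iff' measurableSet_Γ]
  refine Eventually.of_forall fun x hx => hC x ?_
  rw [uIcc_of_le (by linarith [Real.pi_pos])]
  exact Ico_subset_Icc_self hx

theorem IsH1.memLp {u : ℝ → ℂ} (h : IsH1 u) : MemLp u 2 volΓ :=
  h.memLp_top.mono_exponent le_top

theorem absCont_of_dist_le {E F : Type*} [PseudoMetricSpace E] [PseudoMetricSpace F]
    {f : ℝ → E} {g : ℝ → F} {a b : ℝ} (hf : AbsolutelyContinuousOnInterval f a b)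
    (hg : ∀ x y, dist (g x) (g y) ≤ dist (f x) (f y)) :
    AbsolutelyContinuousOnInterval g a b :=
  squeeze_zero (fun _ => Finset.sum_nonneg fun _ _ => dist_nonneg)
    (fun _ => Finset.sum_le_sum fun _ _ => hg _ _) hf

theorem IsH1.const (c : ℂ) : IsH1 (fun _ => c) where
  periodic := fun _ => rfl
  absCont := fun _ _ => by
    rw [absolutelyContinuousOnInterval_iff]
    intro ε hε
    exact ⟨1, one_pos, fun E _ _ => by simpa using hε⟩
  memLp_deriv := by simp

theorem IsH1.add {u v : ℝ → ℂ} (hu : IsH1 u) (hv : IsH1 v) : IsH1 (u + v) where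
  periodic := hu.periodic.add hv.periodic
  absCont := fun a b => (hu.absCont a b).add (hv.absCont a b)
  memLp_deriv := by
    refine (hu.memLp_deriv.add hv.memLp_deriv).ae_eq ?_
    filter_upwards [hu.ae_differentiableAt, hv.ae_differentiableAt] with x h1 h2
    exact (deriv_add h1 h2).symm

theorem IsH1.mul {u v : ℝ → ℂ} (hu : IsH1 u) (hv : IsH1 v) : IsH1 (u * v) where
  periodic := hu.periodic.mul hv.periodic
  absCont := fun a b => (hu.absCont a b).smul (hv.absCont a b)
  memLp_deriv := by
    have h1 : MemLp (deriv u * v) 2 volΓ := hv.memLp_top.mul hu.memLp_deriv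
    have h2 : MemLp (u * deriv v) 2 volΓ := hv.memLp_deriv.mul hu.memLp_top
    refine (h1.add h2).ae_eq ?_
    filter_upwards [hu.ae_differentiableAt, hv.ae_differentiableAt] with x h1 h2
    exact (deriv_mul h1 h2).symm

theorem IsH1.conj {u : ℝ → ℂ} (hu : IsH1 u) : IsH1 (fun x => conj (u x)) where
  periodic := fun x => by simp only [hu.periodic x]
  absCont := fun a b => absCont_of_dist_le (hu.absCont a b) fun x y => by
    rw [Complex.dist_conj_conj]
  memLp_deriv := by
    refine hu.memLp_deriv.star.ae_eq ?_
    filter_upwards [hu.ae_differentiableAt] with x h1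
    exact (h1.hasDerivAt.star.deriv).symm

/-- `H¹_per` as a linear space of functions. -/
def h1Submodule : Submodule ℂ (ℝ → ℂ) where
  carrier := {u | IsH1 u}
  zero_mem' := IsH1.const 0
  add_mem' := IsH1.add
  smul_mem' := fun c _ hu => (IsH1.const c).mul hu

/-- The complex periodic Sobolev space `H¹_per`. -/
def H1 : Type := ↥h1Submodule

instance : AddCommGroup H1 := inferInstanceAs (AddCommGroup ↥h1Submodule)
instance : Module ℂ H1 := inferInstanceAs (Module ℂ ↥h1Submodule)
instance : CoeFun H1 (fun _ => ℝ → ℂ) := ⟨fun u => u.1⟩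

namespace H1

theorem isH1 (u : H1) : IsH1 u := u.2

@[ext] theorem ext {u v : H1} (h : ∀ x, u x = v x) : u = v := Subtype.ext (funext h)

@[simp] theorem add_apply (u v : H1) (x : ℝ) : (u + v) x = u x + v x := rfl
@[simp] theorem smul_apply (c : ℂ) (u : H1) (x : ℝ) : (c • u) x = c * u x := rfl
@[simp] theorem zero_apply (x : ℝ) : (0 : H1) x = 0 := rfl

/-- The constant function `1`. -/
def one : H1 := ⟨fun _ => 1, IsH1.const 1⟩

/-- Pointwise product (`H¹_per` is an algebra). -/
def mul (u v : H1) : H1 := ⟨fun x => u x * v x, u.isH1.mul v.isH1⟩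

/-- Complex conjugation. -/
def conjugate (u : H1) : H1 := ⟨fun x => starRingEnd ℂ (u x), u.isH1.conj⟩

theorem ae_deriv_add (u v : H1) :
    ∀ᵐ x ∂volΓ, deriv ⇑(u + v) x = deriv u x + deriv v x := by
  filter_upwards [u.isH1.ae_differentiableAt, v.isH1.ae_differentiableAt] with x h1 h2
  exact deriv_add h1 h2

theorem deriv_smul' (c : ℂ) (u : H1) (x : ℝ) : deriv ⇑(c • u) x = c * deriv u x :=
  deriv_const_mul_field (v := ⇑u) c

theorem integrable_conj_mul {f g : ℝ → ℂ} (hf : MemLp f 2 volΓ) (hg : MemLp g 2 volΓ) :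
    Integrable (fun x => starRingEnd ℂ (f x) * g x) volΓ :=
  MemLp.integrable_mul (p := 2) (q := 2) hf.star hg

/-- The inner product `⟨u, v⟩ = ∫_Γ ū' v' + ∫_Γ ū v` of `H¹_per`. -/
def innerH1 (u v : H1) : ℂ :=
  (∫ x, starRingEnd ℂ (deriv u x) * deriv v x ∂volΓ) + ∫ x, starRingEnd ℂ (u x) * v x ∂volΓ

theorem integral_conj_mul_self (f : ℝ → ℂ) :
    ∫ x, starRingEnd ℂ (f x) * f x ∂volΓ = ((∫ x, ‖f x‖ ^ 2 ∂volΓ : ℝ) : ℂ) := by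
  refine Eq.trans ?_ integral_complex_ofReal
  refine integral_congr_ae (Eventually.of_forall fun x => ?_)
  simp [Complex.conj_mul']

theorem innerH1_self (u : H1) :
    innerH1 u u = ((∫ x, ‖deriv u x‖ ^ 2 ∂volΓ) + ∫ x, ‖u x‖ ^ 2 ∂volΓ : ℝ) := by
  rw [innerH1, integral_conj_mul_self, integral_conj_mul_self, Complex.ofReal_add]

theorem innerH1_add_left (u v w : H1) : innerH1 (u + v) w = innerH1 u w + innerH1 v w := by
  have h1 : ∫ x, starRingEnd ℂ (deriv ⇑(u + v) x) * deriv w x ∂volΓ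
      = (∫ x, starRingEnd ℂ (deriv u x) * deriv w x ∂volΓ)
        + ∫ x, starRingEnd ℂ (deriv v x) * deriv w x ∂volΓ := by
    rw [← integral_add (integrable_conj_mul u.isH1.memLp_deriv w.isH1.memLp_deriv)
      (integrable_conj_mul v.isH1.memLp_deriv w.isH1.memLp_deriv)]
    refine integral_congr_ae ?_
    filter_upwards [ae_deriv_add u v] with x hx
    rw [hx, map_add, add_mul]
  have h2 : ∫ x, starRingEnd ℂ ((u + v) x) * w x ∂volΓ
      = (∫ x, starRingEnd ℂ (u x) * w x ∂volΓ) + ∫ x, starRingEnd ℂ (v x) * w x ∂volΓ := by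
    rw [← integral_add (integrable_conj_mul u.isH1.memLp w.isH1.memLp)
      (integrable_conj_mul v.isH1.memLp w.isH1.memLp)]
    refine integral_congr_ae (Eventually.of_forall fun x => ?_)
    simp [add_mul]
  rw [innerH1, innerH1, innerH1, h1, h2]
  ring

theorem innerH1_smul_left (u v : H1) (c : ℂ) :
    innerH1 (c • u) v = starRingEnd ℂ c * innerH1 u v := by
  simp only [innerH1, deriv_smul', smul_apply, map_mul, mul_assoc, integral_const_mul]
  ring

theorem innerH1_conj_symm (u v : H1) : starRingEnd ℂ (innerH1 v u) = innerH1 u v := by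
  simp only [innerH1, map_add, ← integral_conj, map_mul, Complex.conj_conj]
  congr 1 <;> refine integral_congr_ae (Eventually.of_forall fun x => ?_) <;> exact mul_comm _ _

theorem eq_zero_of_ae (u : H1) (h : ∀ᵐ x ∂volΓ, u x = 0) : u = 0 := by
  have h1 : EqOn u (fun _ => (0 : ℂ)) (Ioo (-Real.pi) Real.pi) := by
    refine Measure.eqOn_open_of_ae_eq (μ := volume) ?_ isOpen_Ioo u.isH1.continuous.continuousOn
      continuousOn_const
    exact ae_restrict_of_ae_restrict_of_subset Ioo_subset_Ico_self h
  have h2 : EqOn u (fun _ => (0 : ℂ)) (Icc (-Real.pi) Real.pi) := by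
    rw [← closure_Ioo (by linarith [Real.pi_pos])]
    exact h1.closure u.isH1.continuous continuous_const
  ext x
  obtain ⟨y, hy, hxy⟩ := u.isH1.periodic.exists_mem_Ico (by positivity) x (-Real.pi)
  rw [hxy, zero_apply]
  exact h2 ⟨hy.1, by linarith [hy.2]⟩

theorem integrable_sq {f : ℝ → ℂ} (hf : MemLp f 2 volΓ) :
    Integrable (fun x => ‖f x‖ ^ 2) volΓ :=
  (memLp_two_iff_integrable_sq_norm hf.1).1 hf

theorem innerH1_definite (u : H1) (h : innerH1 u u = 0) : u = 0 := by
  rw [innerH1_self, Complex.ofReal_eq_zero] at h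
  have h1 : 0 ≤ ∫ x, ‖deriv u x‖ ^ 2 ∂volΓ := integral_nonneg fun _ => by positivity
  have h2 : 0 ≤ ∫ x, ‖u x‖ ^ 2 ∂volΓ := integral_nonneg fun _ => by positivity
  have h3 : ∫ x, ‖u x‖ ^ 2 ∂volΓ = 0 := by linarith
  rw [integral_eq_zero_iff_of_nonneg (fun _ => by positivity) (integrable_sq u.isH1.memLp)] at h3
  refine eq_zero_of_ae u ?_
  filter_upwards [h3] with x hx
  simpa using hx

/-- The inner product space structure of `H¹_per`, before the norm is derived from it. -/
@[reducible]
def core : InnerProductSpace.Core ℂ H1 where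
  inner := innerH1
  conj_inner_symm := innerH1_conj_symm
  re_inner_nonneg := fun u => by
    rw [innerH1_self]
    exact add_nonneg (integral_nonneg fun _ => by positivity)
      (integral_nonneg fun _ => by positivity)
  add_left := innerH1_add_left
  smul_left := innerH1_smul_left
  definite := innerH1_definite

instance : NormedAddCommGroup H1 := core.toNormedAddCommGroup
instance : InnerProductSpace ℂ H1 := InnerProductSpace.ofCore core.toCore

theorem inner_def (u v : H1) : inner ℂ u v =
    (∫ x, starRingEnd ℂ (deriv u x) * deriv v x ∂volΓ)
      + ∫ x, starRingEnd ℂ (u x) * v x ∂volΓ := rfl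

theorem norm_sq_eq (u : H1) :
    ‖u‖ ^ 2 = (∫ x, ‖deriv u x‖ ^ 2 ∂volΓ) + ∫ x, ‖u x‖ ^ 2 ∂volΓ := by
  have h : inner ℂ u u = innerH1 u u := rfl
  rw [← inner_self_eq_norm_sq (𝕜 := ℂ) u, h, innerH1_self]
  exact Complex.ofReal_re _

/-- A bound on the oscillation over the unit cell. -/
theorem norm_sub_le (u : H1) {x y : ℝ} (hx : x ∈ Γ) (hy : y ∈ Γ) :
    ‖u x - u y‖ ≤ ∫ t, ‖deriv u t‖ ∂volΓ := by
  obtain ⟨c, hc, hcu⟩ : ∃ c : ℂ, ‖c‖ = 1 ∧ (c * (u x - u y)).re = ‖u x - u y‖ := by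
    by_cases h : u x - u y = 0
    · exact ⟨1, by simp, by simp [h]⟩
    · have hn : (‖u x - u y‖ : ℂ) ≠ 0 := by simpa using h
      refine ⟨starRingEnd ℂ (u x - u y) / ‖u x - u y‖, ?_, ?_⟩
      · rw [norm_div, RCLike.norm_conj, Complex.norm_real, norm_norm, div_self (by simpa using h)]
      · rw [div_mul_eq_mul_div, Complex.conj_mul', sq, mul_div_assoc, div_self hn, mul_one,
          Complex.ofReal_re]
  have hac : AbsolutelyContinuousOnInterval (fun t => (c * u t).re) y x := by
    refine absCont_of_dist_le (u.isH1.absCont y x) fun s t => ?_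
    rw [Real.dist_eq, ← Complex.sub_re, ← mul_sub, dist_eq_norm]
    refine (Complex.abs_re_le_norm _).trans ?_
    rw [norm_mul, hc, one_mul]
  have hsub : uIoc y x ⊆ Γ := by
    intro t ht
    rw [uIoc, Set.mem_Ioc] at ht
    refine ⟨?_, ht.2.trans_lt (max_lt hy.2 hx.2)⟩
    exact (le_min hy.1 hx.1).trans ht.1.le
  have hL1 : Integrable (fun t => ‖deriv u t‖) volΓ :=
    (u.isH1.memLp_deriv.integrable (by norm_num)).norm
  have h1 := hac.integral_deriv_eq_sub
  have h2 : (c * u x).re - (c * u y).re = ‖u x - u y‖ := by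
    rw [← Complex.sub_re, ← mul_sub, hcu]
  rw [← h2, ← h1]
  refine (Real.le_norm_self _).trans
    ((intervalIntegral.norm_integral_le_integral_norm_uIoc).trans ?_)
  calc ∫ t in uIoc y x, ‖deriv (fun t => (c * u t).re) t‖
      ≤ ∫ t in uIoc y x, ‖deriv u t‖ := by
        refine integral_mono_of_nonneg (Eventually.of_forall fun _ => norm_nonneg _)
          (IntegrableOn.mono_set (s := uIoc y x) (t := Γ) hL1 hsub) ?_
        filter_upwards [ae_restrict_of_ae_restrict_of_subset hsub u.isH1.ae_differentiableAt]
          with t ht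
        have h3 : HasDerivAt (fun t => (c * u t).re) (c * deriv u t).re t :=
          (Complex.reCLM.hasFDerivAt.comp_hasDerivAt t (ht.hasDerivAt.const_mul c))
        rw [h3.deriv]
        refine (Complex.abs_re_le_norm _).trans ?_
        rw [norm_mul, hc, one_mul]
    _ ≤ ∫ t, ‖deriv u t‖ ∂volΓ :=
        setIntegral_mono_set (s := uIoc y x) (t := Γ) hL1
          (Eventually.of_forall fun _ => norm_nonneg _) (LE.le.eventuallyLE hsub)

theorem volΓ_real_univ : volΓ.real univ = 2 * Real.pi := by
  rw [volΓ, measureReal_restrict_apply_univ, Γ, Real.volume_real_Ico_of_le (by linarith [Real.pi_pos])]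
  ring

theorem integral_norm_le {f : ℝ → ℂ} (hf : MemLp f 2 volΓ) {s : ℝ} (hs : 0 < s)
    (h : ∫ x, ‖f x‖ ^ 2 ∂volΓ ≤ s ^ 2) : ∫ x, ‖f x‖ ∂volΓ ≤ (1 + 2 * Real.pi) / 2 * s := by
  have h1 : ∫ x, 2 * s * ‖f x‖ ∂volΓ ≤ ∫ x, (‖f x‖ ^ 2 + s ^ 2) ∂volΓ := by
    refine integral_mono ((hf.integrable (by norm_num)).norm.const_mul _)
      ((integrable_sq hf).add (integrable_const _)) fun x => ?_
    simp only
    nlinarith [sq_nonneg (‖f x‖ - s)]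
  rw [integral_const_mul, integral_add (integrable_sq hf) (integrable_const _), integral_const,
    volΓ_real_univ, smul_eq_mul] at h1
  have h2 : 2 * s * ∫ x, ‖f x‖ ∂volΓ ≤ 2 * s * ((1 + 2 * Real.pi) / 2 * s) := by nlinarith
  exact le_of_mul_le_mul_left h2 (by positivity)

/-- Sobolev's inequality on the unit cell. -/
theorem norm_apply_le (u : H1) {x : ℝ} (hx : x ∈ Γ) : ‖u x‖ ≤ (1 + 2 * Real.pi) * ‖u‖ := by
  rcases eq_or_ne u 0 with rfl | hu
  · simp
  have hs : 0 < ‖u‖ := norm_pos_iff.2 hu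
  have hsq := norm_sq_eq u
  have p1 : 0 ≤ ∫ x, ‖deriv u x‖ ^ 2 ∂volΓ := integral_nonneg fun _ => by positivity
  have p2 : 0 ≤ ∫ x, ‖u x‖ ^ 2 ∂volΓ := integral_nonneg fun _ => by positivity
  have h1 := integral_norm_le u.isH1.memLp hs (by linarith)
  have h2 := integral_norm_le u.isH1.memLp_deriv hs (by linarith)
  have h3 : ∫ _y, ‖u x‖ ∂volΓ ≤ ∫ y, (‖u y‖ + ∫ t, ‖deriv u t‖ ∂volΓ) ∂volΓ := by
    refine integral_mono_ae (integrable_const _)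
      ((u.isH1.memLp.integrable (by norm_num)).norm.add (integrable_const _)) ?_
    rw [volΓ, EventuallyLE, ae_restrict_iff' measurableSet_Γ]
    refine Eventually.of_forall fun y hy => ?_
    have := norm_sub_le u hx hy
    have h4 : ‖u x‖ ≤ ‖u y‖ + ‖u x - u y‖ := norm_le_norm_add_norm_sub' _ _
    exact h4.trans (by simpa [volΓ] using this)
  rw [integral_add (u.isH1.memLp.integrable (by norm_num)).norm (integrable_const _),
    integral_const, integral_const, volΓ_real_univ, smul_eq_mul, smul_eq_mul] at h3
  have hpi : 3 < Real.pi := Real.pi_gt_three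
  have h5 : 2 * Real.pi * ‖u x‖ ≤ 2 * Real.pi * ((1 + 2 * Real.pi) * ‖u‖) := by
    have h6 : 2 * Real.pi * ∫ t, ‖deriv u t‖ ∂volΓ
        ≤ 2 * Real.pi * ((1 + 2 * Real.pi) / 2 * ‖u‖) := by gcongr
    have h7 : 0 < (1 + 2 * Real.pi) / 2 * ‖u‖ := by positivity
    nlinarith
  exact le_of_mul_le_mul_left h5 (by positivity)

end H1

/-! ### `H⁻¹_per`, periodic measures and the associated potentials -/

/-- `H⁻¹_per`, the dual of `H¹_per` with its dual norm; `V φ` is the duality pairing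
`⟨V, φ⟩` (linear in both arguments). -/
abbrev Hm1 : Type := StrongDual ℂ H1

/-- `V` is real-valued, i.e. `V` belongs to `H⁻¹_{per,r}`. -/
def IsRealValued (V : Hm1) : Prop := ∀ φ : H1, V φ.conjugate = conj (V φ)

/-- `𝓜⁺_per`: non-negative `2π`-periodic Borel measures on `ℝ`, finite on the unit cell. -/
structure PerMeasure where
  toMeasure : Measure ℝ
  periodic : ∀ S : Set ℝ, MeasurableSet S →
    toMeasure ((fun x => x + 2 * Real.pi) '' S) = toMeasure S
  finite : toMeasure Γ < ⊤

/-- The restriction of a periodic measure to the unit cell. -/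
def PerMeasure.cell (ν : PerMeasure) : Measure ℝ := ν.toMeasure.restrict Γ

instance (ν : PerMeasure) : IsFiniteMeasure ν.cell :=
  ⟨by rw [PerMeasure.cell, Measure.restrict_apply_univ]; exact ν.finite⟩

/-- Lebesgue measure as a periodic measure. -/
def lebesgue : PerMeasure where
  toMeasure := volume
  periodic := fun S _ => by simp
  finite := by simp [Γ]

theorem ae_norm_apply_le (ν : PerMeasure) (φ : H1) :
    ∀ᵐ x ∂ν.cell, ‖φ x‖ ≤ (1 + 2 * Real.pi) * ‖φ‖ := by
  rw [PerMeasure.cell, ae_restrict_iff' measurableSet_Γ]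
  exact Eventually.of_forall fun x hx => φ.norm_apply_le hx

theorem integrable_cell (ν : PerMeasure) (φ : H1) : Integrable φ ν.cell :=
  Integrable.of_bound φ.isH1.continuous.aestronglyMeasurable _ (ae_norm_apply_le ν φ)

/-- The potential `V_ν ∈ H⁻¹_per` of a periodic measure: `⟨V_ν, φ⟩ = ∫_Γ φ dν`. -/
def potential (ν : PerMeasure) : Hm1 :=
  LinearMap.mkContinuous
    { toFun := fun φ : H1 => ∫ x in Γ, φ x ∂ν.toMeasure
      map_add' := fun φ ψ => integral_add (integrable_cell ν φ) (integrable_cell ν ψ)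
      map_smul' := fun c φ => integral_const_mul c _ }
    ((1 + 2 * Real.pi) * ν.cell.real univ)
    (fun φ => by
      refine (norm_integral_le_of_norm_le_const (ae_norm_apply_le ν φ)).trans (le_of_eq ?_)
      ring)

@[simp] theorem potential_apply (ν : PerMeasure) (φ : H1) :
    potential ν φ = ∫ x in Γ, φ x ∂ν.toMeasure := rfl

/-- The constant potential `B`: `⟨B, φ⟩ = B ∫_Γ φ dx`. -/
def constPotential (B : ℝ) : Hm1 := (B : ℂ) • potential lebesgue

/-- The set `𝓥_B` of real potentials of the form `V_ν - B` with `ν ∈ 𝓜⁺_per`. -/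
def potentialSet (B : ℝ) : Set Hm1 :=
  {V | IsRealValued V ∧ ∃ ν : PerMeasure, V = potential ν - constPotential B}

/-- Weak-* convergence of periodic measures: convergence of `∫_Γ f dν` for every continuous
`2π`-periodic `f`. -/
def WeakStarTendsto (ν : ℕ → PerMeasure) (ν₀ : PerMeasure) : Prop :=
  ∀ f : ℝ → ℂ, Continuous f → Function.Periodic f (2 * Real.pi) →
    Tendsto (fun n => ∫ x in Γ, f x ∂(ν n).toMeasure) atTop (𝓝 (∫ x in Γ, f x ∂ν₀.toMeasure))

/-! ### Bloch fibres and bands -/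

/-- `(-i d/dx + q) v`. -/
def momentum (q : ℝ) (v : H1) (x : ℝ) : ℂ := -Complex.I * deriv v x + (q : ℂ) * v x

/-- The sesquilinear form
`a_q^V(v, w) = ∫_Γ conj((-i d/dx + q) v) (-i d/dx + q) w + ⟨V, v̄ w⟩` on `H¹_per`. -/
def blochForm (V : Hm1) (q : ℝ) (v w : H1) : ℂ :=
  (∫ x in Γ, conj (momentum q v x) * momentum q w x) + V (v.conjugate.mul w)

/-- The graph of the operator `A_q^V` on `L²_per` associated with the form `a_q^V`: `u` is in the
domain and `A_q^V u = f` iff `u ∈ H¹_per`, `f ∈ L²_per` and `a_q^V(v, u) = ⟨v, f⟩` for every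
`v ∈ H¹_per`. -/
def IsBlochImage (V : Hm1) (q : ℝ) (u : H1) (f : ℝ → ℂ) : Prop :=
  MemLp f 2 volΓ ∧ ∀ v : H1, blochForm V q v u = ∫ x in Γ, conj (v x) * f x

/-- `u` is an eigenfunction of `A_q^V` with eigenvalue `μ`. -/
def IsBlochEigenfunction (V : Hm1) (q μ : ℝ) (u : H1) : Prop :=
  u ≠ 0 ∧ IsBlochImage V q u (fun x => (μ : ℂ) * u x)

/-- The band `ε_{q,m}^V`, `m ≥ 1`: the `m`-th lowest eigenvalue of `A_q^V` counted with
multiplicity, that is, the least `t` such that `A_q^V` has `m` linearly independent eigenfunctions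
with eigenvalues at most `t`. -/
def band (V : Hm1) (q : ℝ) (m : ℕ) : ℝ :=
  sInf {t : ℝ | ∃ u : Fin m → H1, LinearIndependent ℂ u ∧
    ∀ i, ∃ μ ≤ t, IsBlochEigenfunction V q μ (u i)}

end HillBands

end

open HillBands

/-! The argument rests on the compactness of the embedding of H¹_per into the continuous functions:
Sobolev's inequality and the Hölder-1/2 estimate place bounded sets under Arzelà–Ascoli
(`H1.isCompact_closure_toBCF`).

Measures. Testing `V n` against 1 bounds the masses of `ν n` on the cell. The cell is carried to the
circle, which is compact and whose continuous functions are the continuous periodic ones, so no mass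
is lost at the missing endpoint π. A limit on the circle is then extended periodically
(`exists_subseq_weakStarTendsto`). The dual norm is a supremum over the unit ball of H¹_per, which
has a finite net in the uniform norm. Weak-* convergence handles the net and bounded mass handles
the distance to it, so the potentials converge in norm (`WeakStarTendsto.tendsto_potential`).

Bands. Since H¹_per is an algebra, replacing (V, q) by (V', q') changes a(v, v) by at most a
constant times (‖V - V'‖ + |q - q'|)‖v‖². Since the measures are non-negative, the forms are
coercive with constants depending only on B when |q| ≤ 1. Successive minimization produces the
eigenvectors directly and identifies each band with a min-max value over trial spaces
(`IsCoerciveForm.variationalEigenvalue_eq`). Coercivity bounds the H¹ error by the form itself,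
hence bounds the shift of every min-max value. A fixed span of exponentials bounds these values from
above, which makes the resulting Lipschitz constant independent of q (`exists_abs_band_sub_le`). -/

open scoped InnerProductSpace

noncomputable section

namespace HillBands

/-! ### Eigenvalues of a closed form with compact embedding -/

section Variational

variable {H L : Type*} [NormedAddCommGroup H] [InnerProductSpace ℂ H]
  [NormedAddCommGroup L] [InnerProductSpace ℂ L]

/-- A bounded hermitian sesquilinear form `a` on `H`, coercive relative to `J : H → L`. -/
structure IsCoerciveForm (J : H →L[ℂ] L) (a : H →L⋆[ℂ] H →L[ℂ] ℂ) (α c : ℝ) : Prop where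
  hermitian : ∀ v w, conj (a v w) = a w v
  pos : 0 < α
  coercive : ∀ v, α * ‖v‖ ^ 2 ≤ (a v v).re + c * ‖J v‖ ^ 2

/-- `J` maps bounded sequences to sequences with a Cauchy subsequence. -/
def IsSeqCompactMap (J : H →L[ℂ] L) : Prop :=
  ∀ (x : ℕ → H) (R : ℝ), (∀ n, ‖x n‖ ≤ R) → ∃ φ : ℕ → ℕ, StrictMono φ ∧ CauchySeq (J ∘ x ∘ φ)

variable {J : H →L[ℂ] L} {a : H →L⋆[ℂ] H →L[ℂ] ℂ} {α c : ℝ}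

/-! ### Constrained minimizers of the Rayleigh quotient -/

theorem form_smul_self (a : H →L⋆[ℂ] H →L[ℂ] ℂ) (z : ℂ) (v : H) :
    (a (z • v) (z • v)).re = ‖z‖ ^ 2 * (a v v).re := by
  have : a (z • v) (z • v) = ((‖z‖ ^ 2 : ℝ) : ℂ) * a v v := by
    simp only [map_smulₛₗ, _root_.smul_apply, smul_eq_mul, RingHom.id_apply]
    rw [← mul_assoc, Complex.mul_conj']
    push_cast
    ring
  rw [this, Complex.re_ofReal_mul]

theorem form_parallelogram (a : H →L⋆[ℂ] H →L[ℂ] ℂ) (v w : H) :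
    (a (v + w) (v + w)).re + (a (v - w) (v - w)).re = 2 * (a v v).re + 2 * (a w w).re := by
  simp only [map_add, map_sub, _root_.add_apply, _root_.sub_apply,
    Complex.add_re, Complex.sub_re]
  ring

theorem norm_map_parallelogram (J : H →L[ℂ] L) (v w : H) :
    ‖J (v + w)‖ ^ 2 + ‖J (v - w)‖ ^ 2 = 2 * ‖J v‖ ^ 2 + 2 * ‖J w‖ ^ 2 := by
  have := parallelogram_law_with_norm ℂ (J v) (J w)
  rw [map_add, map_sub]
  nlinarith

/-- Direct method without weak topologies: coercivity bounds a normalized minimizing sequence, `J`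
makes a subsequence Cauchy in `L`, and the parallelogram law upgrades this to Cauchy in `H`. -/
theorem IsCoerciveForm.exists_minimizer [CompleteSpace H] (ha : IsCoerciveForm J a α c)
    (hJ : IsSeqCompactMap J) (hinj : Function.Injective J) {W : Submodule ℂ H}
    (hW : IsClosed (W : Set H)) {t : ℝ} {w₀ : H} (hw₀ : w₀ ∈ W) (hne : w₀ ≠ 0)
    (hle : (a w₀ w₀).re ≤ t * ‖J w₀‖ ^ 2) :
    ∃ v ∈ W, ∃ s ≤ t, ‖J v‖ = 1 ∧ (a v v).re = s ∧ ∀ w ∈ W, s * ‖J w‖ ^ 2 ≤ (a w w).re := by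
  have hJpos : ∀ w : H, w ≠ 0 → 0 < ‖J w‖ := fun w hw =>
    norm_pos_iff.2 fun h => hw (hinj (by rw [h, map_zero]))
  set S : Set ℝ := {r | ∃ w ∈ W, ‖J w‖ = 1 ∧ (a w w).re = r} with hS
  have hnorm : ∀ w ∈ W, w ≠ 0 → (a w w).re / ‖J w‖ ^ 2 ∈ S := by
    intro w hw hw0
    have hp := hJpos w hw0
    refine ⟨((‖J w‖⁻¹ : ℝ) : ℂ) • w, W.smul_mem _ hw, ?_, ?_⟩
    · rw [map_smul, norm_smul, Complex.norm_real, norm_inv, norm_norm, inv_mul_cancel₀ hp.ne']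
    · rw [form_smul_self, Complex.norm_real, norm_inv, norm_norm]
      field_simp
  have hbdd : BddBelow S := by
    refine ⟨-c, ?_⟩
    rintro r ⟨w, -, hw1, rfl⟩
    have := ha.coercive w
    rw [hw1] at this
    have h2 : 0 ≤ α * ‖w‖ ^ 2 := mul_nonneg ha.pos.le (sq_nonneg _)
    linarith
  set s := sInf S with hs
  have hmin : ∀ w ∈ W, s * ‖J w‖ ^ 2 ≤ (a w w).re := by
    intro w hw
    rcases eq_or_ne w 0 with rfl | hw0
    · simp
    · have := csInf_le hbdd (hnorm w hw hw0)
      rwa [le_div_iff₀ (by have := hJpos w hw0; positivity)] at this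
  have hSne : S.Nonempty := ⟨_, hnorm w₀ hw₀ hne⟩
  have hst : s ≤ t := (csInf_le hbdd (hnorm w₀ hw₀ hne)).trans
    ((div_le_iff₀ (by have := hJpos w₀ hne; positivity)).2 hle)
  obtain ⟨r, -, hrlim, hrS⟩ := exists_seq_tendsto_sInf hSne hbdd
  choose x hxW hx1 hxr using hrS
  obtain ⟨R, hR⟩ := hrlim.bddAbove_range
  have hxb : ∀ n, ‖x n‖ ≤ Real.sqrt ((R + c) / α) := by
    intro n
    refine Real.le_sqrt_of_sq_le ?_
    rw [le_div_iff₀ ha.pos]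
    have h1 := ha.coercive (x n)
    have h2 : r n ≤ R := hR ⟨n, rfl⟩
    rw [hx1, hxr] at h1
    linarith
  obtain ⟨φ, hφ, hcau⟩ := hJ x _ hxb
  have hr' : Tendsto (r ∘ φ) atTop (𝓝 s) := hrlim.comp hφ.tendsto_atTop
  -- Coercivity is applied to the difference, and the parallelogram law trades its form value for
  -- that of the sum, which minimality bounds below by s‖J(sum)‖² = s(4 - ‖J(difference)‖²).
  have key : ∀ m n, α * ‖x (φ m) - x (φ n)‖ ^ 2 ≤
      2 * (r (φ m) - s) + 2 * (r (φ n) - s)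
        + (s + c) * ‖J (x (φ m)) - J (x (φ n))‖ ^ 2 := by
    intro m n
    have h1 := form_parallelogram a (x (φ m)) (x (φ n))
    have h2 := norm_map_parallelogram J (x (φ m)) (x (φ n))
    have h3 := hmin _ (W.add_mem (hxW (φ m)) (hxW (φ n)))
    have h4 := ha.coercive (x (φ m) - x (φ n))
    rw [hxr, hxr] at h1
    rw [hx1, hx1] at h2
    have h5 : s * ‖J (x (φ m) + x (φ n))‖ ^ 2
        = s * (4 - ‖J (x (φ m) - x (φ n))‖ ^ 2) := by
      congr 1
      linarith
    rw [← map_sub]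
    nlinarith
  have hxc : CauchySeq (x ∘ φ) := by
    rw [cauchySeq_iff_tendsto_dist_atTop_0]
    have hJ0 := cauchySeq_iff_tendsto_dist_atTop_0.1 hcau
    have hlim : Tendsto (fun p : ℕ × ℕ => Real.sqrt ((2 * (r (φ p.1) - s) + 2 * (r (φ p.2) - s)
        + (s + c) * ‖J (x (φ p.1)) - J (x (φ p.2))‖ ^ 2) / α)) atTop (𝓝 0) := by
      have e1 : Tendsto (fun p : ℕ × ℕ => r (φ p.1)) atTop (𝓝 s) := by
        rw [← prod_atTop_atTop_eq]
        exact hr'.comp tendsto_fst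
      have e2 : Tendsto (fun p : ℕ × ℕ => r (φ p.2)) atTop (𝓝 s) := by
        rw [← prod_atTop_atTop_eq]
        exact hr'.comp tendsto_snd
      have e3 : Tendsto (fun p : ℕ × ℕ => ‖J (x (φ p.1)) - J (x (φ p.2))‖) atTop (𝓝 0) := by
        simpa [dist_eq_norm] using hJ0
      have e := (((((e1.sub_const s).const_mul 2).add ((e2.sub_const s).const_mul 2)).add
        ((e3.pow 2).const_mul (s + c))).div_const α).sqrt
      simpa using e
    refine squeeze_zero (fun _ => dist_nonneg) (fun p => ?_) hlim
    refine Real.le_sqrt_of_sq_le ?_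
    rw [le_div_iff₀ ha.pos, mul_comm, dist_eq_norm]
    exact key p.1 p.2
  obtain ⟨v, hv⟩ := cauchySeq_tendsto_of_complete hxc
  have hvW : v ∈ W := hW.mem_of_tendsto hv (Eventually.of_forall fun n => hxW _)
  refine ⟨v, hvW, s, hst, ?_, ?_, hmin⟩
  · have h1 := ((J.continuous.tendsto v).comp hv).norm
    refine tendsto_nhds_unique h1 ?_
    have : (fun n => ‖(J ∘ x ∘ φ) n‖) = fun _ => (1 : ℝ) := funext fun n => hx1 _
    exact this ▸ tendsto_const_nhds
  · have hcont : Continuous fun w => (a w w).re :=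
      Complex.continuous_re.comp (a.continuous.clm_apply continuous_id)
    refine tendsto_nhds_unique ((hcont.tendsto v).comp hv) ?_
    refine hr'.congr fun n => ?_
    exact (hxr _).symm

/-- A minimizer of the Rayleigh quotient is a weak eigenvector. -/
theorem IsCoerciveForm.eq_of_minimizer (ha : IsCoerciveForm J a α c) {W : Submodule ℂ H} {v : H}
    (hv : v ∈ W) {s : ℝ} (h1 : ‖J v‖ = 1) (hvs : (a v v).re = s)
    (hmin : ∀ w ∈ W, s * ‖J w‖ ^ 2 ≤ (a w w).re) {w : H} (hw : w ∈ W) :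
    a w v = s * ⟪J w, J v⟫_ℂ := by
  set d : ℂ := a w v - s * ⟪J w, J v⟫_ℂ with hd
  -- Minimality at v + z w: the terms of order zero cancel, leaving a linear and a quadratic part in
  -- z.
  have key : ∀ z : ℂ, 0 ≤ 2 * (conj z * d).re
      + ‖z‖ ^ 2 * ((a w w).re - s * ‖J w‖ ^ 2) := by
    intro z
    have h2 := hmin (v + z • w) (W.add_mem hv (W.smul_mem z hw))
    have e1 : (a (v + z • w) (v + z • w)).re
        = s + 2 * (conj z * a w v).re + ‖z‖ ^ 2 * (a w w).re := by
      have : a v (z • w) = conj (a (z • w) v) := (ha.hermitian _ _).symm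
      rw [map_add (a _), map_add a, _root_.add_apply, _root_.add_apply, this, Complex.add_re,
        Complex.add_re, Complex.add_re, Complex.conj_re, form_smul_self, hvs, map_smulₛₗ,
        _root_.smul_apply, smul_eq_mul]
      ring
    have e2 : ‖J (v + z • w)‖ ^ 2
        = 1 + 2 * (conj z * ⟪J w, J v⟫_ℂ).re + ‖z‖ ^ 2 * ‖J w‖ ^ 2 := by
      rw [map_add, add_comm, norm_add_sq (𝕜 := ℂ), h1, map_smul, inner_smul_left, norm_smul,
        mul_pow, RCLike.re_eq_complex_re]
      ring
    rw [e1, e2] at h2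
    have e3 : (conj z * d).re
        = (conj z * a w v).re - s * (conj z * ⟪J w, J v⟫_ℂ).re := by
      rw [hd, mul_sub, Complex.sub_re, mul_left_comm, Complex.re_ofReal_mul]
    rw [e3]
    linarith
  have hd0 : d = 0 := by
    by_contra hne
    have hpos : 0 < ‖d‖ ^ 2 := by positivity
    set Q := (a w w).re - s * ‖J w‖ ^ 2 with hQ
    have hQ0 : 0 ≤ Q := by have := hmin w hw; linarith
    -- With z = -d/(Q+1) the linear part dominates, the total being -‖d‖²(Q+2)/(Q+1)². The added 1
    -- covers Q = 0.
    have h3 := key (((-(1 / (Q + 1)) : ℝ) : ℂ) * d)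
    have e4 : (conj (((-(1 / (Q + 1)) : ℝ) : ℂ) * d) * d).re = -(1 / (Q + 1)) * ‖d‖ ^ 2 := by
      rw [map_mul, Complex.conj_ofReal, mul_assoc, Complex.conj_mul', Complex.re_ofReal_mul]
      norm_cast
    rw [e4, norm_mul, Complex.norm_real, mul_pow, Real.norm_eq_abs, sq_abs] at h3
    have hQ1 : 0 < Q + 1 := by linarith
    have e5 : 2 * (-(1 / (Q + 1)) * ‖d‖ ^ 2) + (-(1 / (Q + 1))) ^ 2 * ‖d‖ ^ 2 * Q
        = -(‖d‖ ^ 2 * (Q + 2)) / (Q + 1) ^ 2 := by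
      field_simp
      ring
    rw [e5, neg_div, Left.nonneg_neg_iff] at h3
    have : 0 < ‖d‖ ^ 2 * (Q + 2) / (Q + 1) ^ 2 := by positivity
    linarith
  rw [hd, sub_eq_zero] at hd0
  exact hd0

/-- `u` is a weak eigenvector, `a(·, u) = μ ⟨J ·, J u⟩`. -/
def IsWeakEigenvector (J : H →L[ℂ] L) (a : H →L⋆[ℂ] H →L[ℂ] ℂ) (μ : ℝ) (u : H) : Prop :=
  u ≠ 0 ∧ ∀ v, a v u = μ * ⟪J v, J u⟫_ℂ

/-- `m`-dimensional subspaces on which the Rayleigh quotient is at most `t`. -/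
def HasTrialSpace (J : H →L[ℂ] L) (a : H →L⋆[ℂ] H →L[ℂ] ℂ) (m : ℕ) (t : ℝ) : Prop :=
  ∃ u : Fin m → H, LinearIndependent ℂ u ∧
    ∀ v ∈ Submodule.span ℂ (range u), (a v v).re ≤ t * ‖J v‖ ^ 2

/-- The j < m orthogonality conditions cannot annihilate an m-dimensional trial space, so the
constrained minimum is at most t. The minimizer satisfies the eigenvalue equation against
constrained vectors; against the earlier eigenvectors both sides vanish, by their own equations and
hermitian symmetry. -/
theorem IsCoerciveForm.exists_next_eigenvector [CompleteSpace H] (ha : IsCoerciveForm J a α c)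
    (hJ : IsSeqCompactMap J) (hinj : Function.Injective J) {m j : ℕ} (hjm : j < m) {t : ℝ}
    (ht : HasTrialSpace J a m t) {u : Fin j → H} {μ : Fin j → ℝ} (hu : Orthonormal ℂ (J ∘ u))
    (hev : ∀ i, IsWeakEigenvector J a (μ i) (u i)) :
    ∃ v, ‖J v‖ = 1 ∧ (∀ i, ⟪J (u i), J v⟫_ℂ = 0) ∧ ∃ s ≤ t, IsWeakEigenvector J a s v := by
  let P : H →L[ℂ] (Fin j → ℂ) := ContinuousLinearMap.pi fun i => (innerSL ℂ (J (u i))).comp J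
  have hP : ∀ w i, P w i = ⟪J (u i), J w⟫_ℂ := fun w i => rfl
  obtain ⟨x, hx, hxt⟩ := ht
  obtain ⟨w₀, hw₀, hne, hw₀P⟩ : ∃ w ∈ Submodule.span ℂ (range x), w ≠ 0 ∧ P w = 0 := by
    have hlt : Module.finrank ℂ (Fin j → ℂ)
        < Module.finrank ℂ (Submodule.span ℂ (range x)) := by
      rw [finrank_span_eq_card hx]
      simpa using hjm
    have : FiniteDimensional ℂ (Submodule.span ℂ (range x)) :=
      FiniteDimensional.span_of_finite ℂ (finite_range x)
    obtain ⟨⟨w, hw⟩, hwk, hw0⟩ := (Submodule.ne_bot_iff _).1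
      (LinearMap.ker_ne_bot_of_finrank_lt
        (f := P.toLinearMap.comp (Submodule.span ℂ (range x)).subtype) hlt)
    exact ⟨w, hw, fun h => hw0 (Subtype.ext h), hwk⟩
  obtain ⟨v, hvW, s, hst, hv1, hvs, hmin⟩ := ha.exists_minimizer hJ hinj
    (W := P.toLinearMap.ker) (P.isClosed_ker) (w₀ := w₀) hw₀P hne (hxt w₀ hw₀)
  have hvP : ∀ i, ⟪J (u i), J v⟫_ℂ = 0 := fun i => congrFun (hvW : P v = 0) i
  refine ⟨v, hv1, hvP, s, hst, ?_, fun w => ?_⟩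
  · rintro rfl
    simp at hv1
  -- Subtracting the `J`-orthogonal projection onto the earlier eigenvectors makes an arbitrary test
  -- vector admissible.
  set w' : H := w - ∑ i, ⟪J (u i), J w⟫_ℂ • u i with hw'
  have hw'P : w' ∈ P.toLinearMap.ker := by
    change P w' = 0
    ext i
    rw [hP, hw', map_sub, map_sum, inner_sub_right, inner_sum]
    simp only [map_smul, inner_smul_right]
    have h2 : ∀ k, ⟪J (u i), J (u k)⟫_ℂ = if i = k then 1 else 0 :=
      fun k => orthonormal_iff_ite.1 hu i k
    simp [h2]
  have h1 := ha.eq_of_minimizer hvW hv1 hvs hmin hw'P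
  have h3 : ∀ i, a (u i) v = 0 := by
    intro i
    rw [← ha.hermitian, (hev i).2 v, map_mul, inner_conj_symm, hvP i, mul_zero]
  have hw : w = w' + ∑ i, ⟪J (u i), J w⟫_ℂ • u i := by rw [hw']; abel
  have h4 : a (∑ i, ⟪J (u i), J w⟫_ℂ • u i) v = 0 := by
    rw [map_sum, _root_.sum_apply]
    refine Finset.sum_eq_zero fun i _ => ?_
    rw [map_smulₛₗ, _root_.smul_apply, h3, smul_zero]
  have h5 : ⟪J (∑ i, ⟪J (u i), J w⟫_ℂ • u i), J v⟫_ℂ = 0 := by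
    rw [map_sum, sum_inner]
    refine Finset.sum_eq_zero fun i _ => ?_
    rw [map_smul, inner_smul_left, hvP, mul_zero]
  generalize ∑ i, ⟪J (u i), J w⟫_ℂ • u i = y at hw h4 h5
  rw [hw, map_add, _root_.add_apply, h1, h4, map_add, inner_add_left, h5, add_zero,
    add_zero]

theorem IsCoerciveForm.exists_eigenvectors [CompleteSpace H] (ha : IsCoerciveForm J a α c)
    (hJ : IsSeqCompactMap J) (hinj : Function.Injective J) {m : ℕ} {t : ℝ}
    (ht : HasTrialSpace J a m t) :
    ∃ u : Fin m → H, LinearIndependent ℂ u ∧ ∀ i, ∃ μ ≤ t, IsWeakEigenvector J a μ (u i) := by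
  -- The induction carries `J`-orthonormality, which the next step needs and which implies linear
  -- independence.
  suffices h : ∀ j ≤ m, ∃ u : Fin j → H, Orthonormal ℂ (J ∘ u) ∧
      ∀ i, ∃ μ ≤ t, IsWeakEigenvector J a μ (u i) by
    obtain ⟨u, hu, hev⟩ := h m le_rfl
    exact ⟨u, LinearIndependent.of_comp J.toLinearMap hu.linearIndependent, hev⟩
  intro j
  induction j with
  | zero => exact fun _ => ⟨Fin.elim0, ⟨fun i => i.elim0, fun i => i.elim0⟩, fun i => i.elim0⟩
  | succ j ih =>
    intro hj
    obtain ⟨u, hu, hev⟩ := ih (by omega)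
    choose μ hμt hμ using hev
    obtain ⟨v, hv1, hvo, s, hst, hvs⟩ := ha.exists_next_eigenvector hJ hinj (by omega) ht hu hμ
    refine ⟨Fin.snoc u v, ?_, ?_⟩
    · rw [orthonormal_iff_ite]
      intro i k
      have h2 := orthonormal_iff_ite.1 hu
      refine Fin.lastCases ?_ (fun i => ?_) i <;> refine Fin.lastCases ?_ (fun k => ?_) k
      · simp [inner_self_eq_norm_sq_to_K, hv1]
      · simp only [Function.comp_apply, Fin.snoc_last, Fin.snoc_castSucc]
        rw [← inner_conj_symm, hvo, map_zero, if_neg (Fin.castSucc_lt_last k).ne']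
      · simp only [Function.comp_apply, Fin.snoc_last, Fin.snoc_castSucc]
        rw [hvo, if_neg (Fin.castSucc_lt_last i).ne]
      · simpa using h2 i k
    · intro i
      refine Fin.lastCases ?_ (fun i => ?_) i
      · exact ⟨s, hst, by simpa using hvs⟩
      · exact ⟨μ i, hμt i, by simpa using hμ i⟩

/-! ### Eigenvectors as trial spaces, and the min-max characterization -/

theorem IsCoerciveForm.inner_eq_zero (ha : IsCoerciveForm J a α c) {μ μ' : ℝ} {u u' : H}
    (hu : IsWeakEigenvector J a μ u) (hu' : IsWeakEigenvector J a μ' u') (hne : μ ≠ μ') :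
    ⟪J u, J u'⟫_ℂ = 0 := by
  have h1 := hu'.2 u
  rw [← ha.hermitian, hu.2 u', map_mul, inner_conj_symm, Complex.conj_ofReal] at h1
  by_contra h
  exact hne (by exact_mod_cast mul_right_cancel₀ h h1)

/-- The given eigenvectors need not be orthogonal within an eigenspace. Nevertheless t‖Jv‖² - a(v,
v) is a square norm: that of `J` on the combination whose coefficients are rescaled by √(t - μ i).
Cross terms between distinct eigenvalues vanish, and between equal ones the two roots multiply to t
- μ. -/
theorem IsCoerciveForm.hasTrialSpace (ha : IsCoerciveForm J a α c) {m : ℕ} {t : ℝ}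
    {u : Fin m → H} (hu : LinearIndependent ℂ u)
    (hev : ∀ i, ∃ μ ≤ t, IsWeakEigenvector J a μ (u i)) : HasTrialSpace J a m t := by
  choose μ hμt hμ using hev
  refine ⟨u, hu, fun v hv => ?_⟩
  obtain ⟨z, rfl⟩ := (Submodule.mem_span_range_iff_exists_fun ℂ).1 hv
  set ρ : Fin m → ℝ := fun i => Real.sqrt (t - μ i) with hρ
  have hρsq : ∀ i, ρ i * ρ i = t - μ i := fun i => Real.mul_self_sqrt (by linarith [hμt i])
  have key : t * ⟪J (∑ i, z i • u i), J (∑ i, z i • u i)⟫_ℂ - a (∑ i, z i • u i) (∑ i, z i • u i)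
      = ⟪J (∑ i, ((ρ i : ℂ) * z i) • u i), J (∑ i, ((ρ i : ℂ) * z i) • u i)⟫_ℂ := by
    have eJ : ∀ y : Fin m → ℂ, ⟪J (∑ i, y i • u i), J (∑ i, y i • u i)⟫_ℂ
        = ∑ i, ∑ k, conj (y i) * (y k * ⟪J (u i), J (u k)⟫_ℂ) := by
      intro y
      simp only [map_sum, map_smul]
      rw [sum_inner]
      refine Finset.sum_congr rfl fun i _ => ?_
      rw [inner_smul_left, inner_sum, Finset.mul_sum]
      exact Finset.sum_congr rfl fun k _ => by rw [inner_smul_right]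
    have ea : a (∑ i, z i • u i) (∑ i, z i • u i)
        = ∑ i, ∑ k, conj (z i) * (z k * (μ k * ⟪J (u i), J (u k)⟫_ℂ)) := by
      rw [map_sum a, _root_.sum_apply]
      refine Finset.sum_congr rfl fun i _ => ?_
      rw [map_smulₛₗ, _root_.smul_apply, map_sum, smul_eq_mul, Finset.mul_sum]
      exact Finset.sum_congr rfl fun k _ => by rw [map_smul, (hμ k).2, smul_eq_mul]
    rw [eJ, eJ, ea]
    simp only [Finset.mul_sum, ← Finset.sum_sub_distrib, map_mul, Complex.conj_ofReal]
    refine Finset.sum_congr rfl fun i _ => Finset.sum_congr rfl fun k _ => ?_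
    by_cases hik : μ i = μ k
    · have : ρ i = ρ k := by simp only [hρ, hik]
      have h2 : (ρ k : ℂ) * ρ k = t - μ k := by exact_mod_cast hρsq k
      simp only [this]
      linear_combination (-(conj (z i) * z k * ⟪J (u i), J (u k)⟫_ℂ)) * h2
    · have e := ha.inner_eq_zero (hμ i) (hμ k) hik
      simp [e]
  have h3 := congrArg Complex.re key
  have hre : ∀ y : L, (⟪y, y⟫_ℂ).re = ‖y‖ ^ 2 := inner_self_eq_norm_sq (𝕜 := ℂ)
  rw [Complex.sub_re, Complex.re_ofReal_mul, hre, hre] at h3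
  nlinarith [sq_nonneg ‖J (∑ i, ((ρ i : ℂ) * z i) • u i)‖]

/-- The `m`-th variational eigenvalue. -/
def variationalEigenvalue (J : H →L[ℂ] L) (a : H →L⋆[ℂ] H →L[ℂ] ℂ) (m : ℕ) : ℝ :=
  sInf {t : ℝ | ∃ u : Fin m → H, LinearIndependent ℂ u ∧
    ∀ i, ∃ μ ≤ t, IsWeakEigenvector J a μ (u i)}

/-- The two sets of admissible t coincide, so attainment of the infimum is never needed. -/
theorem IsCoerciveForm.variationalEigenvalue_eq [CompleteSpace H] (ha : IsCoerciveForm J a α c)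
    (hJ : IsSeqCompactMap J) (hinj : Function.Injective J) (m : ℕ) :
    variationalEigenvalue J a m = sInf {t | HasTrialSpace J a m t} := by
  rw [variationalEigenvalue]
  congr 1
  ext t
  exact ⟨fun ⟨_, hu, hev⟩ => ha.hasTrialSpace hu hev, fun h => ha.exists_eigenvectors hJ hinj h⟩

/-! ### Perturbation of the min-max values -/

theorem IsCoerciveForm.neg_le_of_hasTrialSpace (ha : IsCoerciveForm J a α c)
    (hinj : Function.Injective J) {m : ℕ} (hm : 1 ≤ m) {t : ℝ} (h : HasTrialSpace J a m t) :
    -c ≤ t := by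
  obtain ⟨u, hu, hut⟩ := h
  -- A nonzero trial vector exists only for m ≥ 1; for m = 0 every t is admissible and no lower
  -- bound holds.
  have h0 : u ⟨0, hm⟩ ≠ 0 := hu.ne_zero _
  have h1 := hut _ (Submodule.subset_span ⟨⟨0, hm⟩, rfl⟩)
  have h2 := ha.coercive (u ⟨0, hm⟩)
  have h3 : 0 < ‖J (u ⟨0, hm⟩)‖ ^ 2 := by
    have : J (u ⟨0, hm⟩) ≠ 0 := fun h => h0 (hinj (by rw [h, map_zero]))
    positivity
  have h4 : 0 ≤ α * ‖u ⟨0, hm⟩‖ ^ 2 := mul_nonneg ha.pos.le (sq_nonneg _)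
  by_contra hlt
  push Not at hlt
  nlinarith [mul_pos (sub_pos.2 hlt) h3]

/-- Coercivity gives η‖v‖² ≤ (η/α)(a(v, v) + c‖Jv‖²), and on the trial space the bracket is at most
(t + c)‖Jv‖². -/
theorem HasTrialSpace.perturb (ha : IsCoerciveForm J a α c) {a' : H →L⋆[ℂ] H →L[ℂ] ℂ} {η : ℝ}
    (hη : 0 ≤ η) (h : ∀ v, (a' v v).re ≤ (a v v).re + η * ‖v‖ ^ 2) {m : ℕ} {t : ℝ}
    (ht : HasTrialSpace J a m t) : HasTrialSpace J a' m (t + η / α * (t + c)) := by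
  obtain ⟨u, hu, hut⟩ := ht
  refine ⟨u, hu, fun v hv => (h v).trans ?_⟩
  have h1 := hut v hv
  have h2 := ha.coercive v
  have h3 : η * ‖v‖ ^ 2 ≤ η / α * ((a v v).re + c * ‖J v‖ ^ 2) := by
    rw [div_mul_eq_mul_div, le_div_iff₀ ha.pos]
    nlinarith
  have h4 : η / α * ((a v v).re + c * ‖J v‖ ^ 2) ≤ η / α * ((t + c) * ‖J v‖ ^ 2) := by
    have : 0 ≤ η / α := div_nonneg hη ha.pos.le
    gcongr
    linarith
  linarith

/-- One-sided perturbation bound for variational eigenvalues. -/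
theorem IsCoerciveForm.variationalEigenvalue_le [CompleteSpace H] {a' : H →L⋆[ℂ] H →L[ℂ] ℂ}
    (ha : IsCoerciveForm J a α c) (ha' : IsCoerciveForm J a' α c)
    (hJ : IsSeqCompactMap J) (hinj : Function.Injective J) {η : ℝ} (hη : 0 ≤ η)
    (h : ∀ v, (a' v v).re ≤ (a v v).re + η * ‖v‖ ^ 2) {m : ℕ} (hm : 1 ≤ m) {R : ℝ}
    (hR : HasTrialSpace J a m R) :
    variationalEigenvalue J a' m ≤ variationalEigenvalue J a m + η / α * (R + c) := by
  rw [ha.variationalEigenvalue_eq hJ hinj, ha'.variationalEigenvalue_eq hJ hinj]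
  set S := {t | HasTrialSpace J a m t}
  have hb : BddBelow S := ⟨-c, fun t ht => ha.neg_le_of_hasTrialSpace hinj hm ht⟩
  have hb' : BddBelow {t | HasTrialSpace J a' m t} :=
    ⟨-c, fun t ht => ha'.neg_le_of_hasTrialSpace hinj hm ht⟩
  have hηα : 0 ≤ η / α := div_nonneg hη ha.pos.le
  have h1 : ∀ t ∈ S, (sInf {t | HasTrialSpace J a' m t} - η / α * (R + c)) ≤ t := by
    intro t ht
    -- The perturbation error grows with t, so above R the reference trial space is used instead.
    rcases le_total t R with htR | htR
    · have h2 := csInf_le hb' (show _ ∈ {t | HasTrialSpace J a' m t} from ht.perturb ha hη h)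
      have h3 : η / α * (t + c) ≤ η / α * (R + c) := by gcongr
      linarith
    · have h2 := csInf_le hb' (show _ ∈ {t | HasTrialSpace J a' m t} from hR.perturb ha hη h)
      linarith
  have := le_csInf ⟨R, hR⟩ h1
  linarith

theorem IsCoerciveForm.abs_variationalEigenvalue_sub_le [CompleteSpace H]
    {a' : H →L⋆[ℂ] H →L[ℂ] ℂ} (ha : IsCoerciveForm J a α c) (ha' : IsCoerciveForm J a' α c)
    (hJ : IsSeqCompactMap J) (hinj : Function.Injective J) {η : ℝ}
    (h : ∀ v, |(a v v).re - (a' v v).re| ≤ η * ‖v‖ ^ 2) (hη : 0 ≤ η) {m : ℕ} (hm : 1 ≤ m) {R : ℝ}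
    (hR : HasTrialSpace J a m R) (hR' : HasTrialSpace J a' m R) :
    |variationalEigenvalue J a m - variationalEigenvalue J a' m| ≤ η / α * (R + c) := by
  have h1 := ha.variationalEigenvalue_le ha' hJ hinj hη
    (fun v => by linarith [(abs_le.1 (h v)).1]) hm hR
  have h2 := ha'.variationalEigenvalue_le ha hJ hinj hη
    (fun v => by linarith [(abs_le.1 (h v)).2]) hm hR'
  rw [abs_le]
  constructor <;> linarith

/-- A trial space common to all forms with a given bound. -/
theorem exists_uniform_hasTrialSpace (hinj : Function.Injective J) {m : ℕ} {u : Fin m → H}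
    (hu : LinearIndependent ℂ u) (K : ℝ) :
    ∃ R, ∀ a : H →L⋆[ℂ] H →L[ℂ] ℂ, (∀ v, (a v v).re ≤ K * ‖v‖ ^ 2) → HasTrialSpace J a m R := by
  have : FiniteDimensional ℂ (Submodule.span ℂ (range u)) :=
    FiniteDimensional.span_of_finite ℂ (finite_range u)
  have hker : (J.comp (Submodule.span ℂ (range u)).subtypeL).toLinearMap.ker = ⊥ :=
    LinearMap.ker_eq_bot.2 fun x y hxy => Subtype.ext (hinj hxy)
  obtain ⟨C, -, hC⟩ := LinearMap.exists_antilipschitzWith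
    (J.comp (Submodule.span ℂ (range u)).subtypeL).toLinearMap hker
  -- On the finite-dimensional span the injective `J` satisfies ‖v‖ ≤ C‖Jv‖. The maximum with 0
  -- allows for negative K.
  refine ⟨max K 0 * (C : ℝ) ^ 2, fun a ha => ⟨u, hu, fun v hv => (ha v).trans ?_⟩⟩
  have h1 : ‖v‖ ≤ C * ‖J v‖ := by
    simpa [dist_eq_norm] using hC.le_mul_dist (⟨v, hv⟩ : Submodule.span ℂ (range u)) 0
  calc K * ‖v‖ ^ 2 ≤ max K 0 * (C * ‖J v‖) ^ 2 := by
        gcongr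
        exact le_max_left _ _
    _ = _ := by ring

end Variational

/-! ### Absolute continuity of complex functions -/

theorem integral_deriv_eq_sub_of_absCont {u : ℝ → ℂ} {a b : ℝ}
    (h : AbsolutelyContinuousOnInterval u a b) (hi : IntervalIntegrable (deriv u) volume a b) :
    ∫ x in a..b, deriv u x = u b - u a := by
  have hre : AbsolutelyContinuousOnInterval (fun x => (u x).re) a b :=
    absCont_of_dist_le h fun x y => by
      rw [Real.dist_eq, ← Complex.sub_re, dist_eq_norm]
      exact Complex.abs_re_le_norm _
  have him : AbsolutelyContinuousOnInterval (fun x => (u x).im) a b :=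
    absCont_of_dist_le h fun x y => by
      rw [Real.dist_eq, ← Complex.sub_im, dist_eq_norm]
      exact Complex.abs_im_le_norm _
  have hd := h.boundedVariationOn.ae_differentiableAt_of_mem_uIcc
  have h1 : ∫ x in a..b, (deriv u x).re = ∫ x in a..b, deriv (fun x => (u x).re) x := by
    refine intervalIntegral.integral_congr_ae ?_
    filter_upwards [hd] with x hx hxm
    exact ((Complex.reCLM.hasFDerivAt.comp_hasDerivAt x
      (hx (uIoc_subset_uIcc hxm)).hasDerivAt).deriv).symm
  have h2 : ∫ x in a..b, (deriv u x).im = ∫ x in a..b, deriv (fun x => (u x).im) x := by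
    refine intervalIntegral.integral_congr_ae ?_
    filter_upwards [hd] with x hx hxm
    exact ((Complex.imCLM.hasFDerivAt.comp_hasDerivAt x
      (hx (uIoc_subset_uIcc hxm)).hasDerivAt).deriv).symm
  have e1 := Complex.reCLM.intervalIntegral_comp_comm hi
  have e2 := Complex.imCLM.intervalIntegral_comp_comm hi
  simp only [Complex.reCLM_apply, Complex.imCLM_apply] at e1 e2
  apply Complex.ext
  · rw [← e1, h1, hre.integral_deriv_eq_sub, Complex.sub_re]
  · rw [← e2, h2, him.integral_deriv_eq_sub, Complex.sub_im]

/-- Increments of the primitive are dominated by those of the primitive of ‖G‖, which is absolutely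
continuous. -/
theorem absCont_const_add_integral {G : ℝ → ℂ} (hG : ∀ a b, IntervalIntegrable G volume a b)
    (c : ℂ) (p a b : ℝ) : AbsolutelyContinuousOnInterval (fun x => c + ∫ t in p..x, G t) a b := by
  refine absCont_of_dist_le ((hG a b).norm.absolutelyContinuousOnInterval_intervalIntegral
    left_mem_uIcc) fun x y => ?_
  rw [dist_add_left, dist_eq_norm, Real.dist_eq,
    intervalIntegral.integral_interval_sub_left (hG _ _) (hG _ _),
    intervalIntegral.integral_interval_sub_left (hG _ _).norm (hG _ _).norm]
  exact intervalIntegral.norm_integral_le_abs_integral_norm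

/-! ### `H¹_per` and `L²_per` -/

/-- `L²_per`. -/
abbrev L2Γ : Type := Lp ℂ 2 volΓ

theorem inner_toLp {f g : ℝ → ℂ} (hf : MemLp f 2 volΓ) (hg : MemLp g 2 volΓ) :
    ⟪hf.toLp f, hg.toLp g⟫_ℂ = ∫ x, conj (f x) * g x ∂volΓ := by
  rw [L2.inner_def]
  refine integral_congr_ae ?_
  filter_upwards [hf.coeFn_toLp, hg.coeFn_toLp] with x h1 h2
  rw [h1, h2, RCLike.inner_apply, mul_comm]

theorem norm_toLp_sq {f : ℝ → ℂ} (hf : MemLp f 2 volΓ) :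
    ‖hf.toLp f‖ ^ 2 = ∫ x, ‖f x‖ ^ 2 ∂volΓ := by
  have h := inner_self_eq_norm_sq (𝕜 := ℂ) (hf.toLp f)
  rw [inner_toLp, H1.integral_conj_mul_self] at h
  rw [← h]
  exact Complex.ofReal_re _

/-- Cauchy–Schwarz against the indicator of s. -/
theorem norm_setIntegral_le (g : L2Γ) {s : Set ℝ} (hs : MeasurableSet s) :
    ‖∫ x in s, g x ∂volΓ‖ ≤ Real.sqrt (volΓ.real s) * ‖g‖ := by
  have h := norm_inner_le_norm (𝕜 := ℂ) (indicatorConstLp 2 hs (measure_ne_top volΓ s) (1 : ℂ)) g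
  rw [L2.inner_indicatorConstLp_one, norm_indicatorConstLp (by norm_num) (by norm_num)] at h
  rw [Real.sqrt_eq_rpow]
  simpa using h

namespace H1

/-- The inclusion `H¹_per → L²_per`, as a linear map. -/
def toL2Linear : H1 →ₗ[ℂ] L2Γ where
  toFun u := u.isH1.memLp.toLp u
  map_add' u v := (MemLp.toLp_add u.isH1.memLp v.isH1.memLp)
  map_smul' c u := (MemLp.toLp_const_smul c u.isH1.memLp)

/-- The derivative `H¹_per → L²_per`, as a linear map. -/
def derivLinear : H1 →ₗ[ℂ] L2Γ where
  toFun u := u.isH1.memLp_deriv.toLp (deriv u)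
  map_add' u v := by
    rw [← MemLp.toLp_add]
    exact MemLp.toLp_congr _ _ (ae_deriv_add u v)
  map_smul' c u := by
    rw [RingHom.id_apply, ← MemLp.toLp_const_smul]
    exact MemLp.toLp_congr _ _ (Eventually.of_forall fun x => deriv_smul' c u x)

theorem norm_toL2Linear_sq (u : H1) : ‖toL2Linear u‖ ^ 2 = ∫ x, ‖u x‖ ^ 2 ∂volΓ :=
  norm_toLp_sq u.isH1.memLp

theorem norm_derivLinear_sq (u : H1) : ‖derivLinear u‖ ^ 2 = ∫ x, ‖deriv u x‖ ^ 2 ∂volΓ :=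
  norm_toLp_sq u.isH1.memLp_deriv

theorem norm_sq_eq' (u : H1) : ‖u‖ ^ 2 = ‖derivLinear u‖ ^ 2 + ‖toL2Linear u‖ ^ 2 := by
  rw [norm_sq_eq, norm_toL2Linear_sq, norm_derivLinear_sq]

theorem norm_toL2Linear_le (u : H1) : ‖toL2Linear u‖ ≤ 1 * ‖u‖ := by
  rw [one_mul]
  refine le_of_sq_le_sq ?_ (norm_nonneg _)
  rw [norm_sq_eq']
  linarith [sq_nonneg ‖derivLinear u‖]

theorem norm_derivLinear_le (u : H1) : ‖derivLinear u‖ ≤ 1 * ‖u‖ := by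
  rw [one_mul]
  refine le_of_sq_le_sq ?_ (norm_nonneg _)
  rw [norm_sq_eq']
  linarith [sq_nonneg ‖toL2Linear u‖]

/-- The inclusion `H¹_per → L²_per`. -/
def toL2 : H1 →L[ℂ] L2Γ := toL2Linear.mkContinuous 1 norm_toL2Linear_le

/-- The derivative `H¹_per → L²_per`. -/
def derivL2 : H1 →L[ℂ] L2Γ := derivLinear.mkContinuous 1 norm_derivLinear_le

theorem toL2_apply (u : H1) : toL2 u = u.isH1.memLp.toLp u := rfl

theorem derivL2_apply (u : H1) : derivL2 u = u.isH1.memLp_deriv.toLp (deriv u) := rfl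

theorem coeFn_toL2 (u : H1) : toL2 u =ᵐ[volΓ] u := u.isH1.memLp.coeFn_toLp

theorem coeFn_derivL2 (u : H1) : derivL2 u =ᵐ[volΓ] deriv u := u.isH1.memLp_deriv.coeFn_toLp

theorem norm_toL2_le (u : H1) : ‖toL2 u‖ ≤ ‖u‖ :=
  (norm_toL2Linear_le u).trans_eq (one_mul _)

theorem norm_derivL2_le (u : H1) : ‖derivL2 u‖ ≤ ‖u‖ :=
  (norm_derivLinear_le u).trans_eq (one_mul _)

theorem norm_sq_eq_add (u : H1) : ‖u‖ ^ 2 = ‖derivL2 u‖ ^ 2 + ‖toL2 u‖ ^ 2 := norm_sq_eq' u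

theorem toL2_injective : Function.Injective toL2 := by
  rw [injective_iff_map_eq_zero]
  intro u hu
  refine eq_zero_of_ae u ?_
  have h := coeFn_toL2 u
  rw [hu] at h
  filter_upwards [h, Lp.coeFn_zero ℂ 2 volΓ] with x h1 h2
  rw [← h1, h2, Pi.zero_apply]

/-! ### Pointwise bounds and primitives -/

theorem intervalIntegrable_of_memLp {f : ℝ → ℂ} (hf : MemLp f 2 volΓ) :
    IntervalIntegrable f volume (-Real.pi) Real.pi := by
  rw [intervalIntegrable_iff_integrableOn_Ico_of_le (by linarith [Real.pi_pos])]
  exact hf.integrable (by norm_num)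

theorem sub_eq_setIntegral (u : H1) {x y : ℝ} (hy : -Real.pi ≤ y) (hyx : y ≤ x)
    (hx : x ≤ Real.pi) : u x - u y = ∫ t in Ico y x, derivL2 u t ∂volΓ := by
  have hsub : Ico y x ⊆ Γ := Ico_subset_Ico hy hx
  have hi : IntervalIntegrable (deriv u) volume y x :=
    (intervalIntegrable_of_memLp u.isH1.memLp_deriv).mono_set (by
      rw [uIcc_of_le hyx, uIcc_of_le (by linarith [Real.pi_pos])]
      exact Icc_subset_Icc hy hx)
  rw [← integral_deriv_eq_sub_of_absCont (u.isH1.absCont y x) hi,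
    intervalIntegral.integral_of_le hyx, ← integral_Ico_eq_integral_Ioc,
    integral_congr_ae (ae_restrict_of_ae (coeFn_derivL2 u)), volΓ,
    Measure.restrict_restrict_of_subset hsub]

theorem volΓ_real_Ico {x y : ℝ} (hy : -Real.pi ≤ y) (hyx : y ≤ x) (hx : x ≤ Real.pi) :
    volΓ.real (Ico y x) = x - y := by
  have hsub : Ico y x ⊆ Γ := Ico_subset_Ico hy hx
  rw [volΓ, measureReal_restrict_apply measurableSet_Ico, inter_eq_left.2 hsub,
    Real.volume_real_Ico_of_le hyx]

/-- `H¹_per` embeds into Hölder functions of exponent `1/2`. -/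
theorem norm_sub_le_sqrt (u : H1) {x y : ℝ} (hx : x ∈ Icc (-Real.pi) Real.pi)
    (hy : y ∈ Icc (-Real.pi) Real.pi) : ‖u x - u y‖ ≤ Real.sqrt |x - y| * ‖derivL2 u‖ := by
  wlog hyx : y ≤ x generalizing x y
  · rw [norm_sub_rev, abs_sub_comm]
    exact this hy hx (le_of_not_ge hyx)
  have h := norm_setIntegral_le (derivL2 u) (measurableSet_Ico (a := y) (b := x))
  rwa [← sub_eq_setIntegral u hy.1 hyx hx.2, volΓ_real_Ico hy.1 hyx hx.2,
    ← abs_of_nonneg (sub_nonneg.2 hyx)] at h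

theorem norm_toL2_le_of_forall (u : H1) {M : ℝ} (h : ∀ x ∈ Γ, ‖u x‖ ≤ M) :
    ‖toL2 u‖ ≤ Real.sqrt (2 * Real.pi) * M := by
  have hM : 0 ≤ M := (norm_nonneg _).trans (h (-Real.pi) ⟨le_rfl, by linarith [Real.pi_pos]⟩)
  refine le_of_sq_le_sq ?_ (by positivity)
  rw [mul_pow, Real.sq_sqrt (by positivity)]
  calc ‖toL2 u‖ ^ 2 = ∫ x, ‖u x‖ ^ 2 ∂volΓ := norm_toL2Linear_sq u
    _ ≤ ∫ _x, M ^ 2 ∂volΓ := by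
      refine integral_mono_ae (integrable_sq u.isH1.memLp) (integrable_const _) ?_
      rw [volΓ, EventuallyLE, ae_restrict_iff' measurableSet_Γ]
      refine Eventually.of_forall fun x hx => ?_
      exact pow_le_pow_left₀ (norm_nonneg _) (h x hx) 2
    _ = _ := by rw [integral_const, volΓ_real_univ, smul_eq_mul]

/-- The norm of `H¹_per` is controlled by a boundary value and the derivative. -/
theorem exists_norm_le : ∃ C, 0 < C ∧ ∀ u : H1, ‖u‖ ≤ C * (‖u (-Real.pi)‖ + ‖derivL2 u‖) := by
  set s := Real.sqrt (2 * Real.pi)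
  have hs : 0 ≤ s := Real.sqrt_nonneg _
  have hpi := Real.pi_pos
  -- The sup norm is at most (1 + s) times the right-hand sum; passing to L² costs a factor s, and
  -- the derivative contributes 1.
  refine ⟨1 + s * (1 + s), by positivity, fun u => ?_⟩
  have h1 : ∀ x ∈ Γ, ‖u x‖ ≤ (1 + s) * (‖u (-Real.pi)‖ + ‖derivL2 u‖) := by
    intro x hx
    have h2 := norm_sub_le_sqrt u (x := x) (y := -Real.pi) ⟨hx.1, hx.2.le⟩ ⟨le_rfl, by linarith⟩
    have h3 : Real.sqrt |x - -Real.pi| ≤ s := by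
      refine Real.sqrt_le_sqrt ?_
      rw [abs_of_nonneg (by linarith [hx.1])]
      linarith [hx.2]
    have h4 : ‖u x‖ ≤ ‖u (-Real.pi)‖ + ‖u x - u (-Real.pi)‖ := norm_le_norm_add_norm_sub' _ _
    have h5 : Real.sqrt |x - -Real.pi| * ‖derivL2 u‖ ≤ s * ‖derivL2 u‖ := by gcongr
    nlinarith [norm_nonneg (u (-Real.pi)), norm_nonneg (derivL2 u),
      mul_nonneg hs (norm_nonneg (u (-Real.pi)))]
  have h6 := norm_toL2_le_of_forall u h1
  have h7 : ‖u‖ ≤ ‖derivL2 u‖ + ‖toL2 u‖ := by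
    refine le_of_sq_le_sq ?_ (by positivity)
    rw [norm_sq_eq_add]
    nlinarith [norm_nonneg (derivL2 u), norm_nonneg (toL2 u)]
  nlinarith [norm_nonneg (u (-Real.pi))]

/-- Every square integrable function of mean zero is the derivative of an element of `H¹_per`. -/
theorem exists_derivL2_eq (c : ℂ) (g : L2Γ) (hg : ∫ x in Γ, g x ∂volΓ = 0) :
    ∃ u : H1, u (-Real.pi) = c ∧ derivL2 u = g := by
  have hpi := Real.two_pi_pos
  -- An honest periodic representative of g on the whole line.
  set G : ℝ → ℂ := fun x => g (toIcoMod hpi (-Real.pi) x) with hGdef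
  have hGp : Function.Periodic G (2 * Real.pi) := fun x => by
    simp only [hGdef, toIcoMod_add_right]
  have hGΓ : ∀ x ∈ Γ, G x = g x := by
    intro x hx
    simp only [hGdef]
    rw [(toIcoMod_eq_self hpi).2]
    refine ⟨hx.1, ?_⟩
    linarith [hx.2]
  have hGae : G =ᵐ[volΓ] g := by
    refine (ae_restrict_iff' measurableSet_Γ).2 ?_
    exact Eventually.of_forall hGΓ
  have hGm : MemLp G 2 volΓ := (Lp.memLp g).ae_eq hGae.symm
  have hend : -Real.pi + 2 * Real.pi = Real.pi := by ring
  have hGi : ∀ a b, IntervalIntegrable G volume a b := by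
    refine hGp.intervalIntegrable (t := -Real.pi) hpi.ne' ?_
    rw [hend]
    exact intervalIntegrable_of_memLp hGm
  -- Mean zero is exactly what makes the primitive F periodic.
  have hG0 : ∫ x in (-Real.pi)..Real.pi, G x = 0 := by
    have h1 : ∫ x in Γ, g x ∂volΓ = ∫ x in Γ, g x := by
      change ∫ x, g x ∂((volume.restrict Γ).restrict Γ) = _
      rw [Measure.restrict_restrict_of_subset Subset.rfl]
    rw [intervalIntegral.integral_of_le (by linarith), ← integral_Ico_eq_integral_Ioc, ← hg, h1]
    exact setIntegral_congr_fun measurableSet_Γ hGΓ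
  set F : ℝ → ℂ := fun x => c + ∫ t in (-Real.pi)..x, G t with hF
  have hFd : deriv F =ᵐ[volΓ] G := by
    rw [volΓ, EventuallyEq, ae_restrict_iff' measurableSet_Γ]
    filter_upwards [(hGi (-Real.pi) Real.pi).ae_hasDerivAt_integral] with x hx hxΓ
    refine ((hx ?_ (-Real.pi) left_mem_uIcc).const_add c).deriv
    rw [uIcc_of_le (by linarith)]
    exact Ico_subset_Icc_self hxΓ
  have hFH : IsH1 F :=
    { periodic := fun x => by
        simp only [hF]
        rw [← intervalIntegral.integral_add_adjacent_intervals (hGi (-Real.pi) x) (hGi x _),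
          hGp.intervalIntegral_add_eq x (-Real.pi), hend, hG0, add_zero]
      absCont := absCont_const_add_integral hGi c _
      memLp_deriv := hGm.ae_eq hFd.symm }
  refine ⟨⟨F, hFH⟩, by simp [hF], ?_⟩
  refine Lp.ext ?_
  exact (coeFn_derivL2 ⟨F, hFH⟩).trans (hFd.trans hGae)

theorem setIntegral_derivL2 (u : H1) : ∫ x in Γ, derivL2 u x ∂volΓ = 0 := by
  have h := sub_eq_setIntegral u (x := Real.pi) (y := -Real.pi) le_rfl (by linarith [Real.pi_pos])
    le_rfl
  have h2 := u.isH1.periodic (-Real.pi)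
  rw [show -Real.pi + 2 * Real.pi = Real.pi by ring] at h2
  rw [Γ, ← h, h2, sub_self]

theorem norm_apply_le' (u : H1) (x : ℝ) : ‖u x‖ ≤ (1 + 2 * Real.pi) * ‖u‖ := by
  obtain ⟨y, hy, hxy⟩ := u.isH1.periodic.exists_mem_Ico (by positivity) x (-Real.pi)
  rw [hxy]
  exact norm_apply_le u ⟨hy.1, by linarith [hy.2]⟩

theorem sub_apply (u v : H1) (x : ℝ) : (u - v) x = u x - v x := rfl

/-- The value at -π and the derivative determine an element and control its norm. Both converge
along a Cauchy sequence, and mean zero passes to the limiting derivative, whose primitive is the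
limit. -/
instance : CompleteSpace H1 := by
  refine Metric.complete_of_cauchySeq_tendsto fun u hu => ?_
  have hpi := Real.pi_pos
  have h1 : CauchySeq fun n => u n (-Real.pi) := by
    rw [cauchySeq_iff_tendsto_dist_atTop_0] at hu ⊢
    refine squeeze_zero (fun _ => dist_nonneg) (fun p => ?_)
      (by simpa using hu.const_mul (1 + 2 * Real.pi))
    rw [dist_eq_norm, dist_eq_norm, ← sub_apply]
    exact norm_apply_le' _ _
  obtain ⟨c, hc⟩ := cauchySeq_tendsto_of_complete h1
  obtain ⟨g, hg⟩ := cauchySeq_tendsto_of_complete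
    (derivL2.uniformContinuous.comp_cauchySeq hu)
  have hg0 : ∫ x in Γ, g x ∂volΓ = 0 := by
    have hcont : Continuous fun g : L2Γ => ∫ x in Γ, g x ∂volΓ := by
      simp_rw [← L2.inner_indicatorConstLp_one measurableSet_Γ (measure_ne_top volΓ Γ)]
      fun_prop
    refine tendsto_nhds_unique ((hcont.tendsto g).comp hg) ?_
    refine tendsto_const_nhds.congr fun n => ?_
    exact (setIntegral_derivL2 (u n)).symm
  obtain ⟨v, hvc, hvg⟩ := exists_derivL2_eq c g hg0
  refine ⟨v, ?_⟩
  obtain ⟨C, hC, hle⟩ := exists_norm_le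
  rw [tendsto_iff_norm_sub_tendsto_zero]
  refine squeeze_zero (fun _ => norm_nonneg _) (fun n => hle (u n - v)) ?_
  have e1 := tendsto_iff_norm_sub_tendsto_zero.1 hc
  have e2 := tendsto_iff_norm_sub_tendsto_zero.1 hg
  have e3 := (e1.add e2).const_mul C
  simp only [add_zero, mul_zero] at e3
  refine e3.congr fun n => ?_
  rw [sub_apply, map_sub, hvc, hvg]
  rfl

/-! ### Compactness of the embedding into continuous functions -/

/-- The closed unit cell. -/
abbrev Cell : Type := Icc (-Real.pi) Real.pi

/-- Restriction of an element of `H¹_per` to the closed unit cell. -/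
def toBCF (u : H1) : BoundedContinuousFunction Cell ℂ :=
  BoundedContinuousFunction.mkOfCompact ⟨fun x => u x, u.isH1.continuous.comp continuous_subtype_val⟩

/-- Arzelà–Ascoli: Sobolev's inequality gives a common bound, and the Hölder estimate gives the
common modulus √|t| R. -/
theorem isCompact_closure_toBCF (R : ℝ) : IsCompact (closure (toBCF '' {u : H1 | ‖u‖ ≤ R})) := by
  refine BoundedContinuousFunction.arzela_ascoli (Metric.closedBall (0 : ℂ) ((1 + 2 * Real.pi) * R))
    (isCompact_closedBall _ _) _ ?_ ?_
  · rintro _ x ⟨u, hu, rfl⟩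
    rw [mem_closedBall_zero_iff]
    refine (norm_apply_le' u x).trans ?_
    have := Real.pi_pos
    exact mul_le_mul_of_nonneg_left hu (by positivity)
  · refine Metric.equicontinuous_of_continuity_modulus (fun t => Real.sqrt |t| * R) ?_ _ ?_
    · have : Continuous fun t : ℝ => Real.sqrt |t| * R := by fun_prop
      simpa using this.tendsto 0
    · rintro x y ⟨_, u, hu, rfl⟩
      rw [abs_of_nonneg dist_nonneg, dist_eq_norm]
      refine (norm_sub_le_sqrt u x.2 y.2).trans ?_
      rw [Subtype.dist_eq, Real.dist_eq]
      exact mul_le_mul_of_nonneg_left ((norm_derivL2_le u).trans hu) (Real.sqrt_nonneg _)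

theorem norm_toL2_sub_le (u v : H1) :
    ‖toL2 u - toL2 v‖ ≤ Real.sqrt (2 * Real.pi) * dist (toBCF u) (toBCF v) := by
  rw [← map_sub]
  refine norm_toL2_le_of_forall _ fun x hx => ?_
  rw [sub_apply, ← dist_eq_norm]
  exact BoundedContinuousFunction.dist_coe_le_dist (f := toBCF u) (g := toBCF v)
    (⟨x, hx.1, hx.2.le⟩ : Cell)

theorem isSeqCompactMap_toL2 : IsSeqCompactMap toL2 := by
  intro x R hx
  obtain ⟨f, -, φ, hφ, hlim⟩ := (isCompact_closure_toBCF R).tendsto_subseq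
    (x := fun n => toBCF (x n)) fun n => subset_closure ⟨x n, hx n, rfl⟩
  refine ⟨φ, hφ, ?_⟩
  have hc := cauchySeq_iff_tendsto_dist_atTop_0.1 hlim.cauchySeq
  rw [cauchySeq_iff_tendsto_dist_atTop_0]
  refine squeeze_zero (fun _ => dist_nonneg) (fun p => ?_)
    ((hc.const_mul (Real.sqrt (2 * Real.pi))).trans_eq (by rw [mul_zero]))
  rw [dist_eq_norm]
  exact norm_toL2_sub_le _ _

/-- Bounded sets of `H¹_per` have finite nets in the uniform norm. -/
theorem exists_finite_net (R : ℝ) {ε : ℝ} (hε : 0 < ε) :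
    ∃ T : Set H1, T.Finite ∧ ∀ u : H1, ‖u‖ ≤ R → ∃ v ∈ T, ∀ x ∈ Γ, ‖u x - v x‖ ≤ ε := by
  have htb : TotallyBounded (toBCF '' {u : H1 | ‖u‖ ≤ R}) :=
    (isCompact_closure_toBCF R).totallyBounded.subset subset_closure
  obtain ⟨T, hTs, hTf, hT⟩ := Metric.finite_approx_of_totallyBounded htb ε hε
  obtain ⟨T', -, hT'f, rfl⟩ : ∃ T' ⊆ {u : H1 | ‖u‖ ≤ R}, T'.Finite ∧ T = toBCF '' T' :=
    exists_subset_image_finite_and.1 ⟨T, hTs, hTf, rfl⟩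
  refine ⟨T', hT'f, fun u hu => ?_⟩
  obtain ⟨_, ⟨v, hv, rfl⟩, hd⟩ := mem_iUnion₂.1 (hT ⟨u, hu, rfl⟩)
  refine ⟨v, hv, fun x hx => ?_⟩
  rw [← dist_eq_norm]
  exact (BoundedContinuousFunction.dist_coe_le_dist (f := toBCF u) (g := toBCF v)
    (⟨x, hx.1, hx.2.le⟩ : Cell)).trans (Metric.mem_ball.1 hd).le

end H1

namespace H1

/-! ### `H¹_per` as a normed algebra -/

/-- In the product and in the Leibniz rule one factor is always bounded uniformly by S times its
norm. The squares add up to 5(S‖u‖‖v‖)², which is below (3S‖u‖‖v‖)². -/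
theorem norm_mul_le' (u v : H1) : ‖u.mul v‖ ≤ 3 * (1 + 2 * Real.pi) * (‖u‖ * ‖v‖) := by
  have hpi := Real.pi_pos
  set S := 1 + 2 * Real.pi with hS
  have hS0 : 0 ≤ S := by positivity
  have hu : ∀ x, ‖u x‖ ≤ S * ‖u‖ := norm_apply_le' u
  have hv : ∀ x, ‖v x‖ ≤ S * ‖v‖ := norm_apply_le' v
  have h1 : ‖toL2 (u.mul v)‖ ^ 2 ≤ (S * ‖v‖) ^ 2 * ‖toL2 u‖ ^ 2 := by
    rw [toL2_apply, toL2_apply, norm_toLp_sq, norm_toLp_sq, ← integral_const_mul]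
    refine integral_mono (integrable_sq (u.mul v).isH1.memLp)
      ((integrable_sq u.isH1.memLp).const_mul _) fun x => ?_
    change ‖u x * v x‖ ^ 2 ≤ _
    rw [norm_mul, mul_pow, mul_comm]
    have := hv x
    gcongr
  have h2 : ‖derivL2 (u.mul v)‖ ^ 2
      ≤ 2 * (S * ‖v‖) ^ 2 * ‖derivL2 u‖ ^ 2 + 2 * (S * ‖u‖) ^ 2 * ‖derivL2 v‖ ^ 2 := by
    rw [derivL2_apply, derivL2_apply, derivL2_apply, norm_toLp_sq, norm_toLp_sq, norm_toLp_sq,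
      ← integral_const_mul, ← integral_const_mul,
      ← integral_add ((integrable_sq u.isH1.memLp_deriv).const_mul _)
        ((integrable_sq v.isH1.memLp_deriv).const_mul _)]
    refine integral_mono_ae (integrable_sq (u.mul v).isH1.memLp_deriv)
      (((integrable_sq u.isH1.memLp_deriv).const_mul _).add
        ((integrable_sq v.isH1.memLp_deriv).const_mul _)) ?_
    filter_upwards [u.isH1.ae_differentiableAt, v.isH1.ae_differentiableAt] with x hx1 hx2
    have hd : deriv (u.mul v) x = deriv u x * v x + u x * deriv v x := deriv_mul hx1 hx2
    have e1 : ‖deriv u x * v x‖ ^ 2 ≤ (S * ‖v‖) ^ 2 * ‖deriv u x‖ ^ 2 := by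
      rw [norm_mul, mul_pow, mul_comm]
      have := hv x
      gcongr
    have e2 : ‖u x * deriv v x‖ ^ 2 ≤ (S * ‖u‖) ^ 2 * ‖deriv v x‖ ^ 2 := by
      rw [norm_mul, mul_pow]
      have := hu x
      gcongr
    have e3 : ‖deriv (u.mul v) x‖ ^ 2 ≤ 2 * ‖deriv u x * v x‖ ^ 2 + 2 * ‖u x * deriv v x‖ ^ 2 := by
      rw [hd]
      have h := norm_add_le (deriv u x * v x) (u x * deriv v x)
      nlinarith [sq_nonneg (‖deriv u x * v x‖ - ‖u x * deriv v x‖),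
        norm_nonneg (deriv u x * v x + u x * deriv v x)]
    change ‖deriv (u.mul v) x‖ ^ 2 ≤ _
    linarith
  have h3 : ‖toL2 u‖ ^ 2 ≤ ‖u‖ ^ 2 := pow_le_pow_left₀ (norm_nonneg _) (norm_toL2_le u) 2
  have h4 : ‖derivL2 u‖ ^ 2 ≤ ‖u‖ ^ 2 := pow_le_pow_left₀ (norm_nonneg _) (norm_derivL2_le u) 2
  have h5 : ‖derivL2 v‖ ^ 2 ≤ ‖v‖ ^ 2 := pow_le_pow_left₀ (norm_nonneg _) (norm_derivL2_le v) 2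
  refine le_of_sq_le_sq ?_ (by positivity)
  rw [norm_sq_eq_add]
  calc ‖derivL2 (u.mul v)‖ ^ 2 + ‖toL2 (u.mul v)‖ ^ 2
      ≤ (2 * (S * ‖v‖) ^ 2 * ‖u‖ ^ 2 + 2 * (S * ‖u‖) ^ 2 * ‖v‖ ^ 2)
          + (S * ‖v‖) ^ 2 * ‖u‖ ^ 2 := by
        refine add_le_add (h2.trans (by gcongr)) (h1.trans (by gcongr))
    _ ≤ (3 * S * (‖u‖ * ‖v‖)) ^ 2 := by
        have : 0 ≤ (S * ‖u‖ * ‖v‖) ^ 2 := sq_nonneg _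
        nlinarith

theorem norm_conjugate (u : H1) : ‖u.conjugate‖ = ‖u‖ := by
  have h1 : ‖toL2 u.conjugate‖ ^ 2 = ‖toL2 u‖ ^ 2 := by
    rw [toL2_apply, toL2_apply, norm_toLp_sq, norm_toLp_sq]
    refine integral_congr_ae (Eventually.of_forall fun x => ?_)
    change ‖conj (u x)‖ ^ 2 = _
    rw [RCLike.norm_conj]
  have h2 : ‖derivL2 u.conjugate‖ ^ 2 = ‖derivL2 u‖ ^ 2 := by
    rw [derivL2_apply, derivL2_apply, norm_toLp_sq, norm_toLp_sq]
    refine integral_congr_ae ?_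
    filter_upwards [u.isH1.ae_differentiableAt] with x hx
    have : deriv u.conjugate x = conj (deriv u x) := hx.hasDerivAt.star.deriv
    rw [this, RCLike.norm_conj]
  have h3 : ‖u.conjugate‖ ^ 2 = ‖u‖ ^ 2 := by rw [norm_sq_eq_add, norm_sq_eq_add u, h1, h2]
  exact (pow_left_inj₀ (norm_nonneg _) (norm_nonneg _) two_ne_zero).1 h3

/-! ### Infinite dimension -/

theorem isH1_of_contDiff {u : ℝ → ℂ} (hp : Function.Periodic u (2 * Real.pi))
    (hu : ContDiff ℝ 1 u) : IsH1 u where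
  periodic := hp
  absCont := fun _ _ => hu.contDiffOn.absolutelyContinuousOnInterval
  memLp_deriv := by
    have hc : Continuous (deriv u) := hu.continuous_deriv le_rfl
    obtain ⟨C, hC⟩ := (isCompact_Icc (a := -Real.pi) (b := Real.pi)).exists_bound_of_continuousOn
      hc.continuousOn
    refine MemLp.of_bound hc.aestronglyMeasurable C ?_
    rw [volΓ, ae_restrict_iff' measurableSet_Γ]
    exact Eventually.of_forall fun x hx => hC x (Ico_subset_Icc_self hx)

/-- The exponential `x ↦ e^{ikx}`. -/
def expPow (k : ℕ) : H1 := ⟨fun x => Complex.exp (x * Complex.I) ^ k, by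
  refine isH1_of_contDiff (fun x => ?_)
    ((Complex.ofRealCLM.contDiff.mul contDiff_const).cexp.pow k)
  congr 1
  push_cast
  rw [add_mul, Complex.exp_periodic]⟩

/-- A linear relation is a polynomial vanishing on the unit circle, hence zero. -/
theorem linearIndependent_expPow (m : ℕ) :
    LinearIndependent ℂ fun k : Fin m => expPow k := by
  rw [Fintype.linearIndependent_iff]
  intro g hg
  set p : Polynomial ℂ := ∑ k : Fin m, Polynomial.monomial k (g k) with hp
  have hsum : ∀ (s : Finset (Fin m)) (x : ℝ), (∑ k ∈ s, g k • expPow k : H1) x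
      = ∑ k ∈ s, g k * Complex.exp (x * Complex.I) ^ (k : ℕ) := by
    intro s x
    induction s using Finset.induction_on with
    | empty => simp
    | insert k s hk ih =>
      rw [Finset.sum_insert hk, Finset.sum_insert hk, add_apply, ih]
      rfl
  have hroot : ∀ x : ℝ, p.IsRoot (Complex.exp (x * Complex.I)) := by
    intro x
    rw [Polynomial.IsRoot.def, hp, Polynomial.eval_finsetSum]
    simp only [Polynomial.eval_monomial]
    rw [← hsum, hg, zero_apply]
  have hp0 : p = 0 := by
    refine Polynomial.eq_zero_of_infinite_isRoot p ?_
    -- The upper half circle is already infinite, since cosine is injective on [0, π].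
    refine Set.Infinite.mono (s := (fun x : ℝ => Complex.exp (x * Complex.I)) '' Icc 0 Real.pi) ?_ ?_
    · rintro _ ⟨x, -, rfl⟩
      exact hroot x
    · refine Set.Infinite.image (fun x hx y hy hxy => ?_) (Icc_infinite Real.pi_pos)
      refine Real.injOn_cos hx hy ?_
      have := congrArg Complex.re hxy
      simpa only [Complex.exp_ofReal_mul_I_re] using this
  intro k
  have := congrArg (fun q => Polynomial.coeff q (k : ℕ)) hp0
  simpa [hp, Polynomial.finsetSum_coeff, Polynomial.coeff_monomial, Fin.val_inj] using this

end H1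

/-! ### The Bloch form as a bounded sesquilinear form -/

/-- The operator `-i d/dx + q` from `H¹_per` to `L²_per`. -/
def momentumL2 (q : ℝ) : H1 →L[ℂ] L2Γ := -Complex.I • H1.derivL2 + (q : ℂ) • H1.toL2

theorem momentumL2_apply (q : ℝ) (v : H1) :
    momentumL2 q v = -Complex.I • H1.derivL2 v + (q : ℂ) • H1.toL2 v := rfl

theorem coeFn_momentumL2 (q : ℝ) (v : H1) : momentumL2 q v =ᵐ[volΓ] momentum q v := by
  rw [momentumL2_apply]
  filter_upwards [Lp.coeFn_add (-Complex.I • H1.derivL2 v) ((q : ℂ) • H1.toL2 v),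
    Lp.coeFn_smul (-Complex.I) (H1.derivL2 v), Lp.coeFn_smul (q : ℂ) (H1.toL2 v),
    H1.coeFn_derivL2 v, H1.coeFn_toL2 v] with x h1 h2 h3 h4 h5
  rw [h1, Pi.add_apply, h2, h3, Pi.smul_apply, Pi.smul_apply, h4, h5]
  rfl

theorem blochForm_eq (V : Hm1) (q : ℝ) (v w : H1) :
    blochForm V q v w = ⟪momentumL2 q v, momentumL2 q w⟫_ℂ + V (v.conjugate.mul w) := by
  rw [blochForm, L2.inner_def]
  congr 1
  refine integral_congr_ae ?_
  filter_upwards [coeFn_momentumL2 q v, coeFn_momentumL2 q w] with x h1 h2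
  rw [h1, h2, RCLike.inner_apply, mul_comm]

theorem norm_momentumL2_le {q : ℝ} (hq : |q| ≤ 1) (v : H1) : ‖momentumL2 q v‖ ≤ 2 * ‖v‖ := by
  rw [momentumL2_apply]
  refine (norm_add_le _ _).trans ?_
  rw [norm_smul, norm_smul, norm_neg, Complex.norm_I, one_mul, Complex.norm_real,
    Real.norm_eq_abs]
  have h1 := H1.norm_derivL2_le v
  have h2 := mul_le_mul hq (H1.norm_toL2_le v) (norm_nonneg _) zero_le_one
  linarith

/-- The algebra constant of `H¹_per`. -/
def algConst : ℝ := 3 * (1 + 2 * Real.pi)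

theorem algConst_nonneg : 0 ≤ algConst := by
  have := Real.pi_pos
  unfold algConst
  positivity

theorem norm_pairing_le (V : Hm1) (v w : H1) :
    ‖V (v.conjugate.mul w)‖ ≤ algConst * ‖V‖ * ‖v‖ * ‖w‖ := by
  refine (V.le_opNorm _).trans ?_
  have := H1.norm_mul_le' v.conjugate w
  rw [H1.norm_conjugate] at this
  calc ‖V‖ * ‖v.conjugate.mul w‖ ≤ ‖V‖ * (algConst * (‖v‖ * ‖w‖)) := by
        gcongr
        exact this
    _ = _ := by ring

/-- The form `a_q^V` as a bounded sesquilinear form on `H¹_per`. -/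
def blochSesq (V : Hm1) (q : ℝ) : H1 →L⋆[ℂ] H1 →L[ℂ] ℂ :=
  LinearMap.mkContinuous₂
    (LinearMap.mk₂'ₛₗ (starRingEnd ℂ) (RingHom.id ℂ) (blochForm V q)
      (fun v₁ v₂ w => by
        have : (v₁ + v₂).conjugate.mul w = v₁.conjugate.mul w + v₂.conjugate.mul w :=
          H1.ext fun x => by
            change conj (v₁ x + v₂ x) * w x = conj (v₁ x) * w x + conj (v₂ x) * w x
            rw [map_add, add_mul]
        rw [blochForm_eq, blochForm_eq, blochForm_eq, this, map_add, map_add, inner_add_left]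
        ring)
      (fun c v w => by
        have : (c • v).conjugate.mul w = conj c • v.conjugate.mul w :=
          H1.ext fun x => by
            change conj (c * v x) * w x = conj c * (conj (v x) * w x)
            rw [map_mul, mul_assoc]
        rw [blochForm_eq, blochForm_eq, this, map_smul, map_smul, inner_smul_left]
        simp only [smul_eq_mul]
        ring)
      (fun v w₁ w₂ => by
        have : v.conjugate.mul (w₁ + w₂) = v.conjugate.mul w₁ + v.conjugate.mul w₂ :=
          H1.ext fun x => by
            change conj (v x) * (w₁ x + w₂ x) = conj (v x) * w₁ x + conj (v x) * w₂ x
            rw [mul_add]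
        rw [blochForm_eq, blochForm_eq, blochForm_eq, this, map_add, map_add, inner_add_right]
        ring)
      (fun c v w => by
        have : v.conjugate.mul (c • w) = c • v.conjugate.mul w :=
          H1.ext fun x => by
            change conj (v x) * (c * w x) = c * (conj (v x) * w x)
            ring
        rw [blochForm_eq, blochForm_eq, this, map_smul, map_smul, inner_smul_right]
        simp only [smul_eq_mul, RingHom.id_apply]
        ring))
    (‖momentumL2 q‖ ^ 2 + algConst * ‖V‖)
    (fun v w => by
      rw [LinearMap.mk₂'ₛₗ_apply, blochForm_eq]
      refine (norm_add_le _ _).trans ?_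
      have h1 := norm_inner_le_norm (𝕜 := ℂ) (momentumL2 q v) (momentumL2 q w)
      have h2 := mul_le_mul ((momentumL2 q).le_opNorm v) ((momentumL2 q).le_opNorm w)
        (norm_nonneg _) (by positivity)
      have h3 := norm_pairing_le V v w
      linarith)

theorem blochSesq_apply (V : Hm1) (q : ℝ) (v w : H1) :
    blochSesq V q v w = ⟪momentumL2 q v, momentumL2 q w⟫_ℂ + V (v.conjugate.mul w) :=
  blochForm_eq V q v w

theorem blochSesq_self_re (V : Hm1) (q : ℝ) (v : H1) :
    (blochSesq V q v v).re = ‖momentumL2 q v‖ ^ 2 + (V (v.conjugate.mul v)).re := by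
  have hre : (⟪momentumL2 q v, momentumL2 q v⟫_ℂ).re = ‖momentumL2 q v‖ ^ 2 :=
    inner_self_eq_norm_sq (𝕜 := ℂ) _
  rw [blochSesq_apply, Complex.add_re, hre]

theorem blochSesq_hermitian {V : Hm1} (hV : IsRealValued V) (q : ℝ) (v w : H1) :
    conj (blochSesq V q v w) = blochSesq V q w v := by
  have : (v.conjugate.mul w).conjugate = w.conjugate.mul v := H1.ext fun x => by
    change conj (conj (v x) * w x) = conj (w x) * v x
    rw [map_mul, Complex.conj_conj, mul_comm]
  rw [blochSesq_apply, blochSesq_apply, map_add, inner_conj_symm, ← hV, this]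

theorem isBlochEigenfunction_iff (V : Hm1) (q μ : ℝ) (u : H1) :
    IsBlochEigenfunction V q μ u ↔ IsWeakEigenvector H1.toL2 (blochSesq V q) μ u := by
  have hint : ∀ v : H1, ∫ x in Γ, conj (v x) * ((μ : ℂ) * u x)
      = μ * ⟪H1.toL2 v, H1.toL2 u⟫_ℂ := by
    intro v
    rw [H1.toL2_apply, H1.toL2_apply, inner_toLp, ← integral_const_mul]
    refine integral_congr_ae (Eventually.of_forall fun x => ?_)
    change conj (v x) * (μ * u x) = μ * (conj (v x) * u x)
    ring
  unfold IsBlochEigenfunction IsBlochImage IsWeakEigenvector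
  simp only [hint]
  exact ⟨fun h => ⟨h.1, h.2.2⟩, fun h => ⟨h.1, u.isH1.memLp.const_mul _, h.2⟩⟩

theorem band_eq_variationalEigenvalue (V : Hm1) (q : ℝ) (m : ℕ) :
    band V q m = variationalEigenvalue H1.toL2 (blochSesq V q) m := by
  simp only [band, variationalEigenvalue, isBlochEigenfunction_iff]

/-- The measure contributes ∫|v|² dν ≥ 0, so only the constant -B remains. -/
theorem neg_le_pairing_re {B : ℝ} {V : Hm1} (hV : V ∈ potentialSet B) (v : H1) :
    -B * ‖H1.toL2 v‖ ^ 2 ≤ (V (v.conjugate.mul v)).re := by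
  obtain ⟨-, ν, rfl⟩ := hV
  have hsq : ∀ x, (v.conjugate.mul v) x = ((‖v x‖ ^ 2 : ℝ) : ℂ) := fun x => by
    change conj (v x) * v x = _
    rw [Complex.conj_mul']
    norm_cast
  have h1 : ∀ μ : Measure ℝ, ∫ x in Γ, (v.conjugate.mul v) x ∂μ
      = ((∫ x in Γ, ‖v x‖ ^ 2 ∂μ : ℝ) : ℂ) := fun μ => by
    rw [← integral_complex_ofReal]
    exact integral_congr_ae (Eventually.of_forall hsq)
  have h2 : ‖H1.toL2 v‖ ^ 2 = ∫ x in Γ, ‖v x‖ ^ 2 := norm_toLp_sq v.isH1.memLp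
  have h3 : 0 ≤ ∫ x in Γ, ‖v x‖ ^ 2 ∂ν.toMeasure := integral_nonneg fun _ => by positivity
  rw [_root_.sub_apply, constPotential, _root_.smul_apply, potential_apply, potential_apply, h1, h1,
    smul_eq_mul, h2, Complex.sub_re, Complex.ofReal_re, Complex.re_ofReal_mul, Complex.ofReal_re]
  change _ ≤ _ - B * ∫ x in Γ, ‖v x‖ ^ 2
  linarith

/-- From ‖v'‖ ≤ ‖(-i d/dx + q)v‖ + ‖v‖ one gets ½‖v'‖² ≤ ‖(-i d/dx + q)v‖² + ‖v‖². Adding ½‖v‖² and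
the lower bound on the potential gives c = B + 3/2, independently of the measure and of q. -/
theorem isCoerciveForm_blochSesq {B : ℝ} {V : Hm1} (hV : V ∈ potentialSet B) {q : ℝ}
    (hq : |q| ≤ 1) : IsCoerciveForm H1.toL2 (blochSesq V q) (1 / 2) (B + 3 / 2) where
  hermitian := blochSesq_hermitian hV.1 q
  pos := by norm_num
  coercive := fun v => by
    have h1 := neg_le_pairing_re hV v
    have h2 : ‖H1.derivL2 v‖ ≤ ‖momentumL2 q v‖ + ‖H1.toL2 v‖ := by
      have h3 : -Complex.I • H1.derivL2 v = momentumL2 q v - (q : ℂ) • H1.toL2 v := by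
        rw [momentumL2_apply]
        abel
      have h4 : ‖-Complex.I • H1.derivL2 v‖ = ‖H1.derivL2 v‖ := by
        rw [norm_smul, norm_neg, Complex.norm_I, one_mul]
      rw [← h4, h3]
      refine (norm_sub_le _ _).trans ?_
      rw [norm_smul, Complex.norm_real, Real.norm_eq_abs]
      have := mul_le_mul_of_nonneg_right hq (norm_nonneg (H1.toL2 v))
      linarith
    rw [blochSesq_self_re, H1.norm_sq_eq_add]
    nlinarith [sq_nonneg (‖momentumL2 q v‖ - ‖H1.toL2 v‖), norm_nonneg (H1.derivL2 v)]

theorem blochSesq_self_re_le {V : Hm1} {K : ℝ} (hK : ‖V‖ ≤ K) {q : ℝ} (hq : |q| ≤ 1) (v : H1) :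
    (blochSesq V q v v).re ≤ (4 + algConst * K) * ‖v‖ ^ 2 := by
  rw [blochSesq_self_re]
  have h1 := pow_le_pow_left₀ (norm_nonneg _) (norm_momentumL2_le hq v) 2
  have h2 := (Complex.re_le_norm _).trans (norm_pairing_le V v v)
  have h3 : algConst * ‖V‖ * ‖v‖ * ‖v‖ ≤ algConst * K * ‖v‖ * ‖v‖ := by
    have := algConst_nonneg
    gcongr
  nlinarith

theorem abs_blochSesq_self_sub_le (V V' : Hm1) {q q' : ℝ} (hq : |q| ≤ 1) (hq' : |q'| ≤ 1)
    (v : H1) : |(blochSesq V q v v).re - (blochSesq V' q' v v).re|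
      ≤ (algConst * ‖V - V'‖ + 4 * |q - q'|) * ‖v‖ ^ 2 := by
  rw [blochSesq_self_re, blochSesq_self_re]
  have h1 : |(V (v.conjugate.mul v)).re - (V' (v.conjugate.mul v)).re|
      ≤ algConst * ‖V - V'‖ * ‖v‖ * ‖v‖ := by
    rw [← Complex.sub_re, ← _root_.sub_apply]
    exact (Complex.abs_re_le_norm _).trans (norm_pairing_le (V - V') v v)
  have h2 : ‖momentumL2 q v - momentumL2 q' v‖ ≤ |q - q'| * ‖v‖ := by
    have : momentumL2 q v - momentumL2 q' v = ((q - q' : ℝ) : ℂ) • H1.toL2 v := by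
      rw [momentumL2_apply, momentumL2_apply, Complex.ofReal_sub, sub_smul]
      abel
    rw [this, norm_smul, Complex.norm_real, Real.norm_eq_abs]
    exact mul_le_mul_of_nonneg_left (H1.norm_toL2_le v) (abs_nonneg _)
  have h3 : |‖momentumL2 q v‖ ^ 2 - ‖momentumL2 q' v‖ ^ 2| ≤ 4 * |q - q'| * ‖v‖ ^ 2 := by
    rw [sq_sub_sq, abs_mul, abs_of_nonneg (by positivity)]
    have h4 := (abs_norm_sub_norm_le (momentumL2 q v) (momentumL2 q' v)).trans h2
    have h5 := norm_momentumL2_le hq v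
    have h6 := norm_momentumL2_le hq' v
    calc _ ≤ (2 * ‖v‖ + 2 * ‖v‖) * (|q - q'| * ‖v‖) := by gcongr
      _ = _ := by ring
  calc _ = |(‖momentumL2 q v‖ ^ 2 - ‖momentumL2 q' v‖ ^ 2)
        + ((V (v.conjugate.mul v)).re - (V' (v.conjugate.mul v)).re)| := by
        congr 1
        ring
    _ ≤ _ := abs_add_le _ _
    _ ≤ _ := by nlinarith

/-- The bands are Lipschitz in the potential and the quasi-momentum, uniformly on bounded subsets
of `𝓥_B`. -/
theorem exists_abs_band_sub_le (B K : ℝ) {m : ℕ} (hm : 1 ≤ m) :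
    ∃ A, 0 ≤ A ∧ ∀ V ∈ potentialSet B, ∀ V' ∈ potentialSet B, ‖V‖ ≤ K → ‖V'‖ ≤ K →
      ∀ q q' : ℝ, |q| ≤ 1 → |q'| ≤ 1 →
        |band V q m - band V' q' m| ≤ A * (‖V - V'‖ + |q - q'|) := by
  obtain ⟨R, hR⟩ := exists_uniform_hasTrialSpace H1.toL2_injective
    (H1.linearIndependent_expPow m) (4 + algConst * K)
  have hα := algConst_nonneg
  -- Here algConst + 4 bounds the change of the form, 2 is 1/α, and R + (B + 3/2) is R + c; the
  -- absolute value ensures A ≥ 0.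
  refine ⟨(algConst + 4) * 2 * |R + (B + 3 / 2)|, by positivity, ?_⟩
  intro V hV V' hV' hVK hVK' q q' hq hq'
  rw [band_eq_variationalEigenvalue, band_eq_variationalEigenvalue]
  have h := (isCoerciveForm_blochSesq hV hq).abs_variationalEigenvalue_sub_le
    (isCoerciveForm_blochSesq hV' hq') H1.isSeqCompactMap_toL2 H1.toL2_injective
    (abs_blochSesq_self_sub_le V V' hq hq') (by positivity) hm
    (hR _ (blochSesq_self_re_le hVK hq)) (hR _ (blochSesq_self_re_le hVK' hq'))
  refine h.trans ?_
  have h1 : algConst * ‖V - V'‖ + 4 * |q - q'| ≤ (algConst + 4) * (‖V - V'‖ + |q - q'|) := by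
    nlinarith [norm_nonneg (V - V'), abs_nonneg (q - q'),
      mul_nonneg hα (abs_nonneg (q - q'))]
  calc (algConst * ‖V - V'‖ + 4 * |q - q'|) / (1 / 2) * (R + (B + 3 / 2))
      ≤ (algConst * ‖V - V'‖ + 4 * |q - q'|) / (1 / 2) * |R + (B + 3 / 2)| := by
        gcongr
        exact le_abs_self _
    _ ≤ ((algConst + 4) * (‖V - V'‖ + |q - q'|)) / (1 / 2) * |R + (B + 3 / 2)| := by gcongr
    _ = _ := by ring

/-! ### Weak-* compactness of periodic measures -/

/-- Bounded sequences of finite measures on a compact metrizable space have weakly convergent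
subsequences. -/
theorem exists_subseq_tendsto_integral {X : Type*} [TopologicalSpace X] [CompactSpace X]
    [TopologicalSpace.MetrizableSpace X] [MeasurableSpace X] [BorelSpace X] [Nonempty X]
    (μ : ℕ → FiniteMeasure X) {C : NNReal} (hC : ∀ n, (μ n).mass ≤ C) :
    ∃ (μ₀ : FiniteMeasure X) (k : ℕ → ℕ), StrictMono k ∧ ∀ f : X → ℂ, Continuous f →
      Tendsto (fun n => ∫ x, f x ∂(μ (k n) : Measure X)) atTop (𝓝 (∫ x, f x ∂(μ₀ : Measure X))) := by
  obtain ⟨c, -, φ, hφ, hc⟩ := (isCompact_Icc (a := (0 : NNReal)) (b := C)).tendsto_subseq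
    (x := fun n => (μ n).mass) fun n => ⟨zero_le, hC n⟩
  -- Masses and normalized measures converge separately. If a mass vanishes, `normalize` is an
  -- arbitrary default, harmless because it is multiplied by 0.
  obtain ⟨P, -, ψ, hψ, hP⟩ := (isCompact_univ (X := ProbabilityMeasure X)).tendsto_subseq
    (x := fun n => (μ (φ n)).normalize) fun n => mem_univ _
  have hreal : ∀ f : X → ℝ, Continuous f →
      Tendsto (fun n => ∫ x, f x ∂(μ (φ (ψ n)) : Measure X)) atTop
        (𝓝 (∫ x, f x ∂((c • P.toFiniteMeasure : FiniteMeasure X) : Measure X))) := by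
    intro f hf
    have h1 := (ProbabilityMeasure.tendsto_iff_forall_integral_tendsto.1 hP)
      (BoundedContinuousFunction.mkOfCompact ⟨f, hf⟩)
    have h2 : Tendsto (fun n => ((μ (φ (ψ n))).mass : ℝ)) atTop (𝓝 c) :=
      NNReal.tendsto_coe.2 (hc.comp hψ.tendsto_atTop)
    have h3 := h2.mul h1
    rw [FiniteMeasure.toMeasure_smul, integral_smul_nnreal_measure]
    refine h3.congr fun n => ?_
    conv_rhs => rw [(μ (φ (ψ n))).self_eq_mass_smul_normalize, FiniteMeasure.toMeasure_smul,
      integral_smul_nnreal_measure]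
    rfl
  refine ⟨c • P.toFiniteMeasure, φ ∘ ψ, hφ.comp hψ, fun f hf => ?_⟩
  have hint : ∀ ρ : FiniteMeasure X, Integrable f (ρ : Measure X) := fun ρ =>
    hf.integrable_of_hasCompactSupport (HasCompactSupport.of_compactSpace f)
  have hsplit : ∀ ρ : FiniteMeasure X, ∫ x, f x ∂(ρ : Measure X)
      = ((∫ x, (f x).re ∂(ρ : Measure X) : ℝ) : ℂ)
        + ((∫ x, (f x).im ∂(ρ : Measure X) : ℝ) : ℂ) * Complex.I :=
    fun ρ => (integral_re_add_im (hint ρ)).symm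
  simp only [hsplit]
  exact (((Complex.continuous_ofReal.tendsto _).comp
    (hreal _ (Complex.continuous_re.comp hf))).add
      (((Complex.continuous_ofReal.tendsto _).comp
        (hreal _ (Complex.continuous_im.comp hf))).mul_const _))

/-- The translate of a measure on the unit cell by `k` periods. -/
def translate (μ : Measure ℝ) (k : ℤ) : Measure ℝ :=
  (μ.restrict Γ).map fun x => x + k * (2 * Real.pi)

theorem translate_apply (μ : Measure ℝ) (k : ℤ) {S : Set ℝ} (hS : MeasurableSet S) :
    translate μ k S = μ ({x | x + k * (2 * Real.pi) ∈ S} ∩ Γ) := by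
  have hm : Measurable fun x : ℝ => x + k * (2 * Real.pi) := by fun_prop
  rw [translate, Measure.map_apply hm hS, Measure.restrict_apply (hm hS)]
  rfl

theorem add_period_notMem {x : ℝ} (hx : x ∈ Γ) {k : ℤ} (hk : k ≠ 0) :
    x + k * (2 * Real.pi) ∉ Γ := by
  intro h
  have hpi := Real.pi_pos
  have h1 := hx.1
  have h2 := hx.2
  have h3 := h.1
  have h4 := h.2
  rcases lt_or_gt_of_ne hk with hk | hk
  · have : (k : ℝ) ≤ -1 := by exact_mod_cast Int.le_sub_one_of_lt hk
    nlinarith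
  · have : (1 : ℝ) ≤ k := by exact_mod_cast hk
    nlinarith

/-- Among the translated copies of the cell only the one with k = 0 meets Γ. -/
theorem sum_translate_restrict (μ : Measure ℝ) :
    (Measure.sum (translate μ)).restrict Γ = μ.restrict Γ := by
  ext S hS
  rw [Measure.restrict_apply hS, Measure.sum_apply _ (hS.inter measurableSet_Γ),
    tsum_eq_single (0 : ℤ), translate_apply _ _ (hS.inter measurableSet_Γ),
    Measure.restrict_apply hS]
  · congr 1
    ext x
    simp
  · intro k hk
    rw [translate_apply _ _ (hS.inter measurableSet_Γ)]
    have : {x | x + k * (2 * Real.pi) ∈ S ∩ Γ} ∩ Γ = ∅ := by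
      ext x
      simp only [mem_inter_iff, mem_ofPred_eq, mem_empty_iff_false, iff_false]
      exact fun h => add_period_notMem h.2 hk h.1.2
    rw [this, measure_empty]

/-- The periodic extension of a finite measure on the unit cell. -/
def periodicExtension (μ : Measure ℝ) [IsFiniteMeasure μ] : PerMeasure where
  toMeasure := Measure.sum (translate μ)
  periodic := fun S hS => by
    have himg : (fun x => x + 2 * Real.pi) '' S = (fun x => x - 2 * Real.pi) ⁻¹' S := by
      ext x
      simp only [mem_image, mem_preimage]
      exact ⟨by rintro ⟨y, hy, rfl⟩; simpa using hy, fun h => ⟨_, h, by ring⟩⟩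
    have hm : MeasurableSet ((fun x => x + 2 * Real.pi) '' S) := by
      rw [himg]
      exact measurable_id.sub_const _ hS
    -- A shift by one period permutes the translates, so the sum is reindexed by k + 1.
    rw [Measure.sum_apply _ hm, Measure.sum_apply _ hS, ← (Equiv.addRight (1 : ℤ)).tsum_eq]
    refine tsum_congr fun k => ?_
    rw [translate_apply _ _ hm, translate_apply _ _ hS, himg]
    congr 2
    ext x
    simp only [mem_ofPred_eq, mem_preimage, Equiv.coe_addRight, Int.cast_add, Int.cast_one]
    rw [show x + ((k : ℝ) + 1) * (2 * Real.pi) - 2 * Real.pi = x + k * (2 * Real.pi) by ring]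
  finite := by
    rw [← Measure.restrict_apply_univ, sum_translate_restrict]
    exact measure_lt_top _ _

/-! ### Transfer between the unit cell and the circle -/

instance fact_two_pi_pos : Fact (0 < 2 * Real.pi) := ⟨Real.two_pi_pos⟩

/-- The unit cell of a periodic measure, as a measure on the circle. -/
def circleMeasure (ν : PerMeasure) : FiniteMeasure (AddCircle (2 * Real.pi)) :=
  ⟨ν.cell.map (fun x : ℝ => (x : AddCircle (2 * Real.pi))), inferInstance⟩

/-- The representative in the unit cell of a point of the circle. -/
def cellLift (y : AddCircle (2 * Real.pi)) : ℝ :=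
  (AddCircle.measurableEquivIco (2 * Real.pi) (-Real.pi) y : ℝ)

theorem measurable_cellLift : Measurable cellLift :=
  measurable_subtype_coe.comp (AddCircle.measurableEquivIco (2 * Real.pi) (-Real.pi)).measurable

theorem cellLift_mem (y : AddCircle (2 * Real.pi)) : cellLift y ∈ Γ := by
  have h := (AddCircle.measurableEquivIco (2 * Real.pi) (-Real.pi) y).2
  exact ⟨h.1, h.2.trans_eq (by ring)⟩

theorem coe_cellLift (y : AddCircle (2 * Real.pi)) : (cellLift y : AddCircle (2 * Real.pi)) = y :=
  (AddCircle.measurableEquivIco (2 * Real.pi) (-Real.pi)).symm_apply_apply y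

theorem continuous_periodic_lift {f : ℝ → ℂ} (hf : Continuous f)
    (hp : Function.Periodic f (2 * Real.pi)) : Continuous hp.lift :=
  continuous_coinduced_dom.2 hf

theorem integral_circleMeasure (ν : PerMeasure) {f : ℝ → ℂ} (hf : Continuous f)
    (hp : Function.Periodic f (2 * Real.pi)) :
    ∫ y, hp.lift y ∂(circleMeasure ν : Measure (AddCircle (2 * Real.pi)))
      = ∫ x in Γ, f x ∂ν.toMeasure := by
  change ∫ y, hp.lift y ∂(ν.cell.map (fun x : ℝ => (x : AddCircle (2 * Real.pi)))) = _
  rw [integral_map AddCircle.measurable_mk'.aemeasurable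
    (continuous_periodic_lift hf hp).aestronglyMeasurable]
  rfl

/-- Continuity of `cellLift` is not needed: a pushforward asks only for measurability, and f at the
lifted point is the induced function on the circle. -/
theorem integral_periodicExtension (μ : FiniteMeasure (AddCircle (2 * Real.pi))) {f : ℝ → ℂ}
    (hf : Continuous f) (hp : Function.Periodic f (2 * Real.pi)) :
    ∫ x in Γ, f x ∂(periodicExtension
      ((μ : Measure (AddCircle (2 * Real.pi))).map cellLift)).toMeasure
      = ∫ y, hp.lift y ∂(μ : Measure (AddCircle (2 * Real.pi))) := by
  rw [periodicExtension, sum_translate_restrict, Measure.restrict_eq_self_of_ae_mem,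
    integral_map measurable_cellLift.aemeasurable hf.aestronglyMeasurable]
  · refine integral_congr_ae (Eventually.of_forall fun y => ?_)
    conv_rhs => rw [← coe_cellLift y]
    rfl
  · exact (ae_map_iff measurable_cellLift.aemeasurable measurableSet_Γ).2
      (Eventually.of_forall cellLift_mem)

/-- Weak-* sequential compactness of bounded sets of periodic measures. -/
theorem exists_subseq_weakStarTendsto (ν : ℕ → PerMeasure) {M : ℝ}
    (hM : ∀ n, (ν n).cell.real univ ≤ M) :
    ∃ (ν₀ : PerMeasure) (k : ℕ → ℕ), StrictMono k ∧ WeakStarTendsto (fun n => ν (k n)) ν₀ := by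
  obtain ⟨μ₀, k, hk, hlim⟩ := exists_subseq_tendsto_integral (fun n => circleMeasure (ν n))
    (C := M.toNNReal) fun n => by
      rw [← NNReal.coe_le_coe]
      refine le_trans (le_of_eq ?_) ((hM n).trans (Real.le_coe_toNNReal M))
      change ((ν n).cell.map (fun x : ℝ => (x : AddCircle (2 * Real.pi)))).real univ = _
      rw [measureReal_def, Measure.map_apply AddCircle.measurable_mk' MeasurableSet.univ,
        preimage_univ, measureReal_def]
  refine ⟨periodicExtension ((μ₀ : Measure (AddCircle (2 * Real.pi))).map cellLift), k, hk,
    fun f hf hp => ?_⟩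
  rw [integral_periodicExtension μ₀ hf hp]
  refine (hlim _ (continuous_periodic_lift hf hp)).congr fun n => ?_
  exact integral_circleMeasure _ hf hp

/-! ### Convergence of potentials and bands -/

theorem norm_potential_apply_le (ν : PerMeasure) (φ : H1) {C : ℝ} (h : ∀ x ∈ Γ, ‖φ x‖ ≤ C) :
    ‖potential ν φ‖ ≤ C * ν.cell.real univ := by
  rw [potential_apply]
  refine norm_integral_le_of_norm_le_const (μ := ν.cell) ?_
  rw [PerMeasure.cell, ae_restrict_iff' measurableSet_Γ]
  exact Eventually.of_forall h

/-- Weak-* convergence of measures with bounded mass implies norm convergence in `H⁻¹_per`. -/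
theorem WeakStarTendsto.tendsto_potential {ν : ℕ → PerMeasure} {ν₀ : PerMeasure}
    (h : WeakStarTendsto ν ν₀) {M : ℝ} (hM : ∀ n, (ν n).cell.real univ ≤ M) :
    Tendsto (fun n => potential (ν n)) atTop (𝓝 (potential ν₀)) := by
  refine (Metric.tendsto_atTop' (α := Hm1)).2 fun ε hε => ?_
  set M' := max M (ν₀.cell.real univ) with hM'
  have hM0 : 0 ≤ M' := measureReal_nonneg.trans (le_max_right _ _)
  -- Chosen so that replacing u by a net point costs at most ε/4 for each measure; the net itself
  -- costs another ε/4. The added 1 covers zero mass.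
  set δ := ε / (4 * (M' + 1)) with hδ
  have hδ0 : 0 < δ := by positivity
  have hδM : δ * M' ≤ ε / 4 := by
    rw [hδ, div_mul_eq_mul_div, div_le_div_iff₀ (by positivity) (by norm_num)]
    nlinarith
  obtain ⟨T, hTf, hT⟩ := H1.exists_finite_net 1 hδ0
  have hev : ∀ᶠ n in atTop, ∀ v ∈ T, ‖potential (ν n) v - potential ν₀ v‖ < ε / 4 := by
    rw [eventually_all_finite hTf]
    intro v _
    have := h v v.isH1.continuous v.isH1.periodic
    exact (tendsto_iff_norm_sub_tendsto_zero.1 this).eventually_lt_const (by positivity)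
  obtain ⟨N, hN⟩ := eventually_atTop.1 hev
  refine ⟨N, fun n hn => ?_⟩
  refine lt_of_eq_of_lt (dist_eq_norm (E := Hm1) _ _) ?_
  refine lt_of_le_of_lt (b := 3 * (ε / 4)) ?_ (by linarith)
  refine ContinuousLinearMap.opNorm_le_of_unit_norm (by positivity) fun u hu => ?_
  obtain ⟨v, hvT, hv⟩ := hT u hu.le
  have h1 : ‖potential (ν n) (u - v)‖ ≤ ε / 4 :=
    (norm_potential_apply_le (ν n) (u - v) hv).trans
      ((mul_le_mul_of_nonneg_left ((hM n).trans (le_max_left _ _)) hδ0.le).trans hδM)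
  have h2 : ‖potential ν₀ (u - v)‖ ≤ ε / 4 :=
    (norm_potential_apply_le ν₀ (u - v) hv).trans
      ((mul_le_mul_of_nonneg_left (le_max_right _ _) hδ0.le).trans hδM)
  have h3 := hN n hn.le v hvT
  have e : (potential (ν n) - potential ν₀) u = potential (ν n) (u - v) - potential ν₀ (u - v)
      + (potential (ν n) v - potential ν₀ v) := by
    rw [_root_.sub_apply, map_sub, map_sub]
    ring
  rw [e]
  refine (norm_add_le _ _).trans ?_
  have h4 := norm_sub_le (potential (ν n) (u - v)) (potential ν₀ (u - v))
  linarith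

theorem isRealValued_potential (ν : PerMeasure) : IsRealValued (potential ν) := by
  intro φ
  rw [potential_apply, potential_apply, ← integral_conj]
  rfl

theorem sub_constPotential_mem (ν : PerMeasure) (B : ℝ) :
    potential ν - constPotential B ∈ potentialSet B := by
  refine ⟨fun φ => ?_, ν, rfl⟩
  rw [_root_.sub_apply, _root_.sub_apply, constPotential, _root_.smul_apply, _root_.smul_apply,
    isRealValued_potential, isRealValued_potential, map_sub, smul_eq_mul, smul_eq_mul, map_mul,
    Complex.conj_ofReal]

theorem potential_one (ν : PerMeasure) : potential ν H1.one = ν.cell.real univ := by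
  rw [potential_apply]
  change ∫ _x, (1 : ℂ) ∂ν.cell = _
  simp

theorem constPotential_one (B : ℝ) : constPotential B H1.one = ((B * (2 * Real.pi) : ℝ) : ℂ) := by
  have h : lebesgue.cell = volΓ := rfl
  rw [constPotential, _root_.smul_apply, potential_one, h, H1.volΓ_real_univ, smul_eq_mul,
    ← Complex.ofReal_mul]

/-! ### Uniform convergence of the bands -/

theorem continuousOn_band {B : ℝ} {V : Hm1} (hV : V ∈ potentialSet B) {m : ℕ} (hm : 1 ≤ m) :
    ContinuousOn (fun q => band V q m) (Icc 0 (1 / 2)) := by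
  obtain ⟨A, hA, h⟩ := exists_abs_band_sub_le B ‖V‖ hm
  have hq : ∀ q ∈ Icc (0 : ℝ) (1 / 2), |q| ≤ 1 := fun q hq =>
    abs_le.2 ⟨by linarith [hq.1], by linarith [hq.2]⟩
  have hL : LipschitzOnWith A.toNNReal (fun q => band V q m) (Icc 0 (1 / 2)) := by
    refine LipschitzOnWith.of_dist_le_mul fun q hqm q' hqm' => ?_
    have hz : ‖V - V‖ = 0 := (congrArg norm (sub_self V)).trans (norm_zero (E := Hm1))
    have := h V hV V hV le_rfl le_rfl q q' (hq q hqm) (hq q' hqm')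
    rwa [hz, zero_add, ← Real.dist_eq, ← Real.dist_eq,
      ← Real.coe_toNNReal A hA] at this
  exact hL.continuousOn

/-- The difference of bands is continuous on a compact interval, so its maximum is attained at some
q n. The Lipschitz bound, whose constant does not depend on q, is then evaluated there. -/
theorem exists_isGreatest_band_sub {B : ℝ} {V : ℕ → Hm1} {V₀ : Hm1}
    (hV : ∀ n, V n ∈ potentialSet B) (hV₀ : V₀ ∈ potentialSet B)
    (hlim : Tendsto V atTop (𝓝 V₀)) {m : ℕ} (hm : 1 ≤ m) :
    ∃ δ : ℕ → ℝ, (∀ n, IsGreatest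
      ((fun q => |band (V n) q m - band V₀ q m|) '' Icc (0 : ℝ) (1 / 2)) (δ n)) ∧
      Tendsto δ atTop (𝓝 0) := by
  have hmax : ∀ n, ∃ q ∈ Icc (0 : ℝ) (1 / 2), IsMaxOn (fun q => |band (V n) q m - band V₀ q m|)
      (Icc 0 (1 / 2)) q := fun n =>
    isCompact_Icc.exists_isMaxOn ⟨0, by norm_num, by norm_num⟩
      ((continuousOn_band (hV n) hm).sub (continuousOn_band hV₀ hm)).abs
  choose q hq hqmax using hmax
  refine ⟨fun n => |band (V n) (q n) m - band V₀ (q n) m|, fun n => ⟨⟨q n, hq n, rfl⟩, ?_⟩, ?_⟩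
  · rintro _ ⟨p, hp, rfl⟩
    exact hqmax n hp
  · have hnorm : Tendsto (fun n => ‖V n‖) atTop (𝓝 ‖V₀‖) := (continuous_norm.tendsto V₀).comp hlim
    obtain ⟨K, hK⟩ := hnorm.bddAbove_range
    have hK' : ∀ n, ‖V n‖ ≤ K := fun n => hK ⟨n, rfl⟩
    obtain ⟨A, -, hA⟩ := exists_abs_band_sub_le B K hm
    have hqn : ∀ n, |q n| ≤ 1 := fun n =>
      abs_le.2 ⟨by linarith [(hq n).1], by linarith [(hq n).2]⟩
    have h1 := ((tendsto_iff_norm_sub_tendsto_zero (E := Hm1)).1 hlim).const_mul A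
    rw [mul_zero] at h1
    refine squeeze_zero (fun _ => abs_nonneg _) (fun n => ?_) h1
    have := hA (V n) (hV n) V₀ hV₀ (hK' n) (le_of_tendsto hnorm (Eventually.of_forall hK'))
      (q n) (q n) (hqn n) (hqn n)
    rwa [sub_self, abs_zero, add_zero] at this

end HillBands

end

open HillBands
theorem proposition4 (B : ℝ) (V : ℕ → Hm1) (hV : ∀ n, V n ∈ potentialSet B)
    (hbdd : BddAbove (Set.range fun n => (V n H1.one).re))
    (ν : ℕ → PerMeasure) (hν : ∀ n, V n = potential (ν n) - constPotential B) :
    ∃ (ν₀ : PerMeasure) (k : ℕ → ℕ), StrictMono k ∧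
      WeakStarTendsto (fun n => ν (k n)) ν₀ ∧
      potential ν₀ - constPotential B ∈ potentialSet B ∧
      Tendsto (fun n => V (k n)) atTop (𝓝 (potential ν₀ - constPotential B)) ∧
      ∀ m : ℕ, 1 ≤ m → ∃ δ : ℕ → ℝ,
        (∀ n, IsGreatest
          ((fun q => |band (V (k n)) q m - band (potential ν₀ - constPotential B) q m|) ''
            Set.Icc (0 : ℝ) (1 / 2)) (δ n)) ∧
        Tendsto δ atTop (𝓝 0) := by
  obtain ⟨R, hR⟩ := hbdd
  -- Pairing with 1 gives the total mass minus 2πB.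
  have hM : ∀ n, (ν n).cell.real univ ≤ R + B * (2 * Real.pi) := by
    intro n
    have h : (V n H1.one).re ≤ R := hR ⟨n, rfl⟩
    rw [hν, _root_.sub_apply, potential_one, constPotential_one, Complex.sub_re, Complex.ofReal_re,
      Complex.ofReal_re] at h
    linarith
  obtain ⟨ν₀, k, hk, hw⟩ := exists_subseq_weakStarTendsto ν hM
  have hlim : Tendsto (fun n => V (k n)) atTop (𝓝 (potential ν₀ - constPotential B)) := by
    simp only [hν]
    exact (hw.tendsto_potential fun n => hM (k n)).sub_const _
  have hmem := sub_constPotential_mem ν₀ B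
  exact ⟨ν₀, k, hk, hw, hmem, hlim, fun m hm =>
    exists_isGreatest_band_sub (fun n => hV (k n)) hmem hlim hm⟩
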